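/- Let $T$ be a finite tree with vertex set $V$, and let $v$ be a central vertex of $T$ (a vertex of minimum eccentricity). Regard $T$ as rooted at $v$: the children of a vertex $u$ are the neighbors $w$ of $u$ with $d(v,w)=d(v,u)+1$; a leaf is a vertex with no children, and an internal vertex is a vertex that has a child; two distinct vertices are siblings if they are children of the same vertex; level $k$ consists of the vertices at distance $k$ from $v$, and the last level is the level farthest from $v$. Call $T$ complete if every leaf lies in the last level. A graceful labeling of $T$ is an injective function $f:V\to\mathbb{Z}_{\ge 0}$ with $f(V)=\{0,1,\dots,|V|-1\}$ such that the numbers $|f(a)-f(b)|$, for $ab$ an edge of $T$, are pairwise distinct. **Theorem.** Suppose that each vertex not in the last two levels has an odd number of children, and that at least one of the following holds: (a) $T$ has diameter $6$ and is complete. (b) $T$ has diameter $6$, no two leaves at distance $2$ from $v$ are siblings, and each leaf at distance $2$ from $v$ has a sibling with an even number of children. (c) $T$ has diameter $2r$ for some integer $r\ge 0$, $T$ is complete, and the number of vertices at distance $r-1$ from $v$ with an even number of children is not congruent to $3$ modulo $4$. (d) $T$ has diameter $2r$ for some integer $r\ge 0$; the number of vertices at distance $r-1$ from $v$ with an even number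 of children (leaves included, $0$ being even) is not congruent to $3$ modulo $4$; no two leaves at distance $r-1$ from $v$ are siblings; and each leaf at distance $r-1$ from $v$ has a sibling with an even number of children. (e) $T$ has diameter $6$ and each internal vertex has an odd number of children. Then $T$ has a graceful labeling $f$ with $f(v)=0$. -/

import Mathlib

namespace GracefulTree

/-- A graceful labeling of a finite graph `G`: an injective labeling of the vertices whose labels
are exactly `0, 1, …, |V| - 1`, such that distinct edges `ab` have distinct induced labels
`|f a - f b|`. -/
def IsGracefulLabeling {V : Type*} [Fintype V] (G : SimpleGraph V) (f : V → ℕ) : Prop :=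
  Function.Injective f ∧
  Set.range f = {k : ℕ | k < Fintype.card V} ∧
  ∀ a b c d : V, G.Adj a b → G.Adj c d →
    |(f a : ℤ) - (f b : ℤ)| = |(f c : ℤ) - (f d : ℤ)| → s(a, b) = s(c, d)

/-- The children of `u` in the tree `T` rooted at `v`: the neighbors of `u` that are one step
farther from the root than `u`. -/
def children {V : Type*} (T : SimpleGraph V) (v u : V) : Set V :=
  {w | T.Adj u w ∧ T.dist v w = T.dist v u + 1}

/-- The number of children of `u` in the tree `T` rooted at `v`. -/
noncomputable def numChildren {V : Type*} (T : SimpleGraph V) (v u : V) : ℕ :=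
  (children T v u).ncard

/-- A leaf of the tree `T` rooted at `v`: a vertex without children. -/
def IsLeaf {V : Type*} (T : SimpleGraph V) (v u : V) : Prop :=
  children T v u = ∅

/-- `a` and `b` are siblings in the tree `T` rooted at `v`: they are distinct vertices with a
common parent. -/
def AreSiblings {V : Type*} (T : SimpleGraph V) (v a b : V) : Prop :=
  a ≠ b ∧ ∃ p : V, a ∈ children T v p ∧ b ∈ children T v p

/-- The last level of the tree `T` rooted at `v`: the largest distance of a vertex from `v`. -/
noncomputable def lastLevel {V : Type*} [Fintype V] (T : SimpleGraph V) (v : V) : ℕ :=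
  Finset.univ.sup (fun u : V => T.dist v u)

/-- The tree `T` rooted at `v` is complete: it has leaves only in the last level. -/
def IsComplete {V : Type*} [Fintype V] (T : SimpleGraph V) (v : V) : Prop :=
  ∀ u : V, IsLeaf T v u → T.dist v u = lastLevel T v

/-- The vertices `u` at distance `r - 1` from `v` (no vertex, if `r = 0`) with an even number of
children; a vertex with no children counts, as `0` is even. -/
def evenVertices {V : Type*} (T : SimpleGraph V) (v : V) (r : ℕ) : Set V :=
  {u | T.dist v u + 1 = r ∧ Even (numChildren T v u)}

/-- No two leaves at distance `r - 1` from `v` are siblings, and each leaf at distance `r - 1`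
from `v` has a sibling with an even number of children. -/
def LeafSiblingConditions {V : Type*} (T : SimpleGraph V) (v : V) (r : ℕ) : Prop :=
  (∀ a b : V, T.dist v a + 1 = r → T.dist v b + 1 = r → IsLeaf T v a → IsLeaf T v b →
    ¬ AreSiblings T v a b) ∧
  (∀ a : V, T.dist v a + 1 = r → IsLeaf T v a →
    ∃ b : V, AreSiblings T v a b ∧ Even (numChildren T v b))

end GracefulTree

/-!
The labeling is built by adding the vertices one at a time, parents first. At each moment the free
labels form an interval `[l, h]`, and the differences still to be realised form an interval
`[d, d + h - l]`. A new vertex always receives the label `l` or `h`, in such a way that its edge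
realises one of the two extreme differences; hence no difference is ever repeated, and the only
question is which trees arise. The parents available for such a step are the vertices labelled
`l - d` and `h + d`, here called the pointers. In terms of the zigzag order `0, n, 1, n - 1, …` of
the labels, a step at one pointer moves the other pointer by two positions, in either direction
(`ParentTree.Partial.exists_insert`).

On the upper levels the steps are chosen such that the new labels follow the zigzag. The tree is
then described by a lattice path with steps `±1`, the parent of the `i`-th vertex being the lower
end of the `i`-th step (`ParentTree.Partial.of_latticePath`). If every vertex has an odd number of
children, then a path that crosses the height `m` once for each child of the `m`-th vertex leads
upwards, so that the levels can be labelled one after the other. On the last level the order is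
irrelevant, and the free choice of the direction is used (`Serve`): a vertex with an odd number of
children lets the pointers advance, and a pair of neighbours with even numbers of children can be
served by visiting the first one twice and the second one in between. After such a pair the
following vertices are visited in pairs of reversed order, until the next such pair; this is the
phase of `ServeAt`.

It remains to order the level before the last. As all numbers of children above are odd, this level
can be arranged in pairs of equal parity and a single vertex (`ParentTree.exists_arranged`): of
the corresponding single vertices of the children of a vertex, two of equal parity are made
neighbours by reversing one of the two lists. If the number `p` of vertices with an even number of
children is even, then the single vertex, whose number of children is odd, comes first; if `p` is
`1` modulo `4`, then it comes last, in the right phase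
(`ParentTree.exists_graceful_of_evensAt_mod_four`). A leaf is paired with a sibling, so that it can
be the vertex visited in between.

In the case of diameter `6` the level in question is the second one. If `p` is `3` modulo `4` and
the level contains a leaf, then this leaf can be put at the end, where it need not be visited
(`ParentTree.exists_graceful_of_leaf`). If its vertices with an even number of children are all
leaves, or none of them is, then a lattice path that goes up, down and up again over the first level
collects the vertices with an odd number of children before the others
(`ParentTree.exists_graceful_of_sorted`); an even stretch at the end is served on the way forward
and back.
-/

set_option linter.unusedSectionVars false

namespace GracefulTree

/-! ### Rooted trees given by a parent function -/

/-- A rooted tree on the vertex set `V`, given by the parent of each vertex; the parent of the root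
is irrelevant. The level function makes the parent relation well-founded. -/
structure ParentTree (V : Type*) where
  /-- the root -/
  root : V
  /-- the parent of a vertex other than the root -/
  par : V → V
  /-- the distance from the root -/
  lev : V → ℕ
  lev_root : lev root = 0
  lev_par : ∀ u, u ≠ root → lev (par u) + 1 = lev u

namespace ParentTree

variable {V : Type*} [Fintype V] [DecidableEq V] (𝒯 : ParentTree V)

/-- The children of `u`. -/
def kids (u : V) : Finset V := {w | w ≠ 𝒯.root ∧ 𝒯.par w = u}

/-- The number of children of `u`. -/
def deg (u : V) : ℕ := (𝒯.kids u).card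

lemma mem_kids {u w : V} : w ∈ 𝒯.kids u ↔ w ≠ 𝒯.root ∧ 𝒯.par w = u := by
  simp [kids]

lemma lev_of_mem_kids {u w : V} (h : w ∈ 𝒯.kids u) : 𝒯.lev w = 𝒯.lev u + 1 := by
  obtain ⟨h1, rfl⟩ := 𝒯.mem_kids.1 h
  exact (𝒯.lev_par w h1).symm

lemma eq_root_of_lev {u : V} (h : 𝒯.lev u = 0) : u = 𝒯.root := by
  by_contra hu
  have := 𝒯.lev_par u hu
  omega

/-- A graceful labeling of a rooted tree, with the root labelled `0`. Since `f` is injective, its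
values in `[0, |V| - 1]` are all of that interval. -/
def Graceful (f : V → ℤ) : Prop :=
  f 𝒯.root = 0 ∧ Function.Injective f ∧ (∀ u, 0 ≤ f u ∧ f u < Fintype.card V) ∧
    ∀ a b, a ≠ 𝒯.root → b ≠ 𝒯.root →
      |f a - f (𝒯.par a)| = |f b - f (𝒯.par b)| → a = b

/-! ### Partial labelings -/

/-- A partial graceful labeling `f`, defined on a set `S` of vertices that is closed under parents:
the labels still free form the interval `[l, h]`, and the edge differences still free form the
interval `[d, d + h - l]`. -/
structure Partial (S : Finset V) (f : V → ℤ) (l h d : ℤ) : Prop where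
  root_mem : 𝒯.root ∈ S
  root_label : f 𝒯.root = 0
  par_mem : ∀ u ∈ S, u ≠ 𝒯.root → 𝒯.par u ∈ S
  inj : ∀ a ∈ S, ∀ b ∈ S, f a = f b → a = b
  range : ∀ u ∈ S, 0 ≤ f u ∧ f u < Fintype.card V
  free : ∀ u ∈ S, ¬ (l ≤ f u ∧ f u ≤ h)
  free_diff : ∀ u ∈ S, u ≠ 𝒯.root →
    ¬ (d ≤ |f u - f (𝒯.par u)| ∧ |f u - f (𝒯.par u)| ≤ d + h - l)
  diff_inj : ∀ a ∈ S, ∀ b ∈ S, a ≠ 𝒯.root → b ≠ 𝒯.root →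
    |f a - f (𝒯.par a)| = |f b - f (𝒯.par b)| → a = b
  card_add : (S.card : ℤ) + (h + 1 - l) = Fintype.card V
  l_nonneg : 0 ≤ l
  h_lt : h < Fintype.card V
  d_pos : 1 ≤ d

variable {𝒯} {S : Finset V} {f g : V → ℤ} {l h d : ℤ}

lemma Partial.congr (H : 𝒯.Partial S f l h d) (hfg : ∀ u ∈ S, f u = g u) :
    𝒯.Partial S g l h d where
  root_mem := H.root_mem
  root_label := by rw [← hfg _ H.root_mem, H.root_label]
  par_mem := H.par_mem
  inj a ha b hb := by rw [← hfg a ha, ← hfg b hb]; exact H.inj a ha b hb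
  range u hu := by rw [← hfg u hu]; exact H.range u hu
  free u hu := by rw [← hfg u hu]; exact H.free u hu
  free_diff u hu hr := by
    rw [← hfg u hu, ← hfg _ (H.par_mem u hu hr)]; exact H.free_diff u hu hr
  diff_inj a ha b hb hra hrb := by
    rw [← hfg a ha, ← hfg b hb, ← hfg _ (H.par_mem a ha hra), ← hfg _ (H.par_mem b hb hrb)]
    exact H.diff_inj a ha b hb hra hrb
  card_add := H.card_add
  l_nonneg := H.l_nonneg
  h_lt := H.h_lt
  d_pos := H.d_pos

lemma Partial.le_of_notMem (H : 𝒯.Partial S f l h d) {w : V} (hw : w ∉ S) : l ≤ h := by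
  have h1 : S.card < Fintype.card V := Finset.card_lt_univ_of_notMem hw
  have := H.card_add
  omega

/-- A new vertex may receive an extreme free label if its edge receives an extreme free
difference. -/
lemma Partial.insert (H : 𝒯.Partial S f l h d) {w : V} (hw : w ∉ S) (hp : 𝒯.par w ∈ S)
    {l' h' d' : ℤ}
    (hx : f w = l ∧ l' = l + 1 ∧ h' = h ∨ f w = h ∧ l' = l ∧ h' = h - 1)
    (hδ : |f w - f (𝒯.par w)| = d ∧ d' = d + 1 ∨
      |f w - f (𝒯.par w)| = d + h - l ∧ d' = d) :
    𝒯.Partial (insert w S) f l' h' d' := by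
  have hlh := H.le_of_notMem hw
  have hl := H.l_nonneg
  have hh := H.h_lt
  have hd := H.d_pos
  have hc := H.card_add
  refine ⟨Finset.mem_insert_of_mem H.root_mem, H.root_label, ?_, ?_, ?_, ?_, ?_, ?_, ?_, ?_, ?_, ?_⟩
  · intro u hu hr
    rcases Finset.mem_insert.1 hu with rfl | hu
    · exact Finset.mem_insert_of_mem hp
    · exact Finset.mem_insert_of_mem (H.par_mem u hu hr)
  · intro a ha b hb hab
    rcases Finset.mem_insert.1 ha with ha | ha <;> rcases Finset.mem_insert.1 hb with hb | hb
    · rw [ha, hb]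
    · have := H.free b hb; rw [← hab, ha] at this; omega
    · have := H.free a ha; rw [hab, hb] at this; omega
    · exact H.inj a ha b hb hab
  · intro u hu
    rcases Finset.mem_insert.1 hu with rfl | hu
    · omega
    · exact H.range u hu
  · intro u hu
    rcases Finset.mem_insert.1 hu with rfl | hu
    · omega
    · have := H.free u hu; omega
  · intro u hu hr
    rcases Finset.mem_insert.1 hu with rfl | hu
    · omega
    · have := H.free_diff u hu hr; omega
  · intro a ha b hb hra hrb hab
    rcases Finset.mem_insert.1 ha with ha | ha <;> rcases Finset.mem_insert.1 hb with hb | hb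
    · rw [ha, hb]
    · have := H.free_diff b hb hrb; rw [← hab, ha] at this; omega
    · have := H.free_diff a ha hra; rw [hab, hb] at this; omega
    · exact H.diff_inj a ha b hb hra hrb hab
  · rw [Finset.card_insert_of_notMem hw]; push_cast; omega
  · omega
  · omega
  · omega

lemma Partial.graceful (H : 𝒯.Partial S f l h d) (hS : ∀ u, u ∈ S) : 𝒯.Graceful f :=
  ⟨H.root_label, fun a b => H.inj a (hS a) b (hS b), fun u => H.range u (hS u),
    fun a b => H.diff_inj a (hS a) b (hS b)⟩

/-! ### Zigzag positions -/

/-- The label at position `p` of the zigzag `0, n, 1, n - 1, 2, …`; it makes sense for all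
integers `p`. -/
def zigzag (n p : ℤ) : ℤ := if p % 2 = 0 then p / 2 else n - p / 2

/-- The pointers of a partial labeling with parameters `l, h, d`: a vertex labelled `l - d` or
`h + d` can receive a child with an extreme label and an extreme difference. `P` and `Q` are the
zigzag positions of these two labels, in either order. -/
def Pointers (n P Q l h d : ℤ) : Prop :=
  (P % 2 = 0 ∧ Q % 2 = 1 ∧ zigzag n P = l - d ∧ zigzag n Q = h + d) ∨
  (P % 2 = 1 ∧ Q % 2 = 0 ∧ zigzag n P = h + d ∧ zigzag n Q = l - d)

lemma Pointers.symm {n P Q l h d : ℤ} (H : Pointers n P Q l h d) : Pointers n Q P l h d := by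
  unfold Pointers at *; tauto

/-- When the vertex at one pointer receives a child, the other pointer moves by two positions, in
the direction of our choice: the choice is that between the labels `l` and `h`. -/
lemma Partial.exists_insert (H : 𝒯.Partial S f l h d) {n P Q Q' : ℤ}
    (hPQ : Pointers n P Q l h d) {w : V} (hw : w ∉ S) (hp : 𝒯.par w ∈ S)
    (hf : f (𝒯.par w) = zigzag n P) (hQ : Q' = Q + 2 ∨ Q' = Q - 2) :
    ∃ x l' h' d', 𝒯.Partial (Insert.insert w S) (Function.update f w x) l' h' d' ∧
      Pointers n P Q' l' h' d' := by
  have hlh := H.le_of_notMem hw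
  have hd := H.d_pos
  have hne : 𝒯.par w ≠ w := fun e => hw (e ▸ hp)
  have key : ∀ x l' h' d',
      (x = l ∧ l' = l + 1 ∧ h' = h ∨ x = h ∧ l' = l ∧ h' = h - 1) →
      (|x - f (𝒯.par w)| = d ∧ d' = d + 1 ∨ |x - f (𝒯.par w)| = d + h - l ∧ d' = d) →
      𝒯.Partial (Insert.insert w S) (Function.update f w x) l' h' d' := by
    intro x l' h' d' h1 h2
    have H' : 𝒯.Partial S (Function.update f w x) l h d :=
      H.congr fun u hu => by
        rw [Function.update_of_ne]; rintro rfl; exact hw hu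
    refine H'.insert hw hp ?_ ?_ <;> simpa [Function.update_of_ne hne] using by assumption
  unfold Pointers zigzag at hPQ
  rw [zigzag] at hf
  rcases hPQ with ⟨h1, h2, h3, h4⟩ | ⟨h1, h2, h3, h4⟩ <;> rcases hQ with hQ | hQ
  · -- the low vertex takes the highest label
    refine ⟨h, l, h - 1, d, key _ _ _ _ (by omega) (Or.inr ⟨?_, rfl⟩), ?_⟩
    · rw [hf, h3, abs_of_nonneg] <;> omega
    · unfold Pointers zigzag; split_ifs at * <;> omega
  · refine ⟨l, l + 1, h, d + 1, key _ _ _ _ (by omega) (Or.inl ⟨?_, rfl⟩), ?_⟩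
    · rw [hf, h3, abs_of_nonneg] <;> omega
    · unfold Pointers zigzag; split_ifs at * <;> omega
  · -- the high vertex takes the lowest label
    refine ⟨l, l + 1, h, d, key _ _ _ _ (by omega) (Or.inr ⟨?_, rfl⟩), ?_⟩
    · rw [hf, h3, abs_of_nonpos] <;> omega
    · unfold Pointers zigzag; split_ifs at * <;> omega
  · refine ⟨h, l, h - 1, d + 1, key _ _ _ _ (by omega) (Or.inl ⟨?_, rfl⟩), ?_⟩
    · rw [hf, h3, abs_of_nonpos] <;> omega
    · unfold Pointers zigzag; split_ifs at * <;> omega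

end ParentTree

/-! ### Serving the last level -/

/-- `Serve P Q c`: with the pointers at the positions `P` and `Q`, every position `p` can be given
its `c p` missing children, the order in which these receive their labels being irrelevant. -/
inductive Serve : ℤ → ℤ → (ℤ → ℕ) → Prop
  | done (P Q : ℤ) : Serve P Q 0
  | symm {P Q : ℤ} {c : ℤ → ℕ} : Serve Q P c → Serve P Q c
  | forward {P Q : ℤ} {c : ℤ → ℕ} : Serve P (Q + 2) c → Serve P Q (Pi.single P 1 + c)
  | backward {P Q : ℤ} {c : ℤ → ℕ} : Serve P (Q - 2) c → Serve P Q (Pi.single P 1 + c)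

namespace ParentTree

variable {V : Type*} [Fintype V] [DecidableEq V] {𝒯 : ParentTree V}

/-- A partial labeling in which the parents of all missing vertices are present extends to a
graceful labeling, if the numbers of missing children can be served. -/
lemma exists_graceful_of_serve {n P Q : ℤ} {c : ℤ → ℕ} (hs : Serve P Q c) (pos : V → ℤ) :
    ∀ {S : Finset V} {f : V → ℤ} {l h d : ℤ}, 𝒯.Partial S f l h d → Pointers n P Q l h d →
      (∀ w, w ∉ S → 𝒯.par w ∈ S ∧ f (𝒯.par w) = zigzag n (pos (𝒯.par w))) →
      (∀ p, c p = (Finset.univ.filter fun w => w ∉ S ∧ pos (𝒯.par w) = p).card) →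
      ∃ f, 𝒯.Graceful f := by
  -- one step of the induction, in which a child of the vertex at `P` is labelled
  have step : ∀ {P Q Q' : ℤ} {c : ℤ → ℕ}, (Q' = Q + 2 ∨ Q' = Q - 2) →
      (∀ {S : Finset V} {f : V → ℤ} {l h d : ℤ}, 𝒯.Partial S f l h d → Pointers n P Q' l h d →
        (∀ w, w ∉ S → 𝒯.par w ∈ S ∧ f (𝒯.par w) = zigzag n (pos (𝒯.par w))) →
        (∀ p, c p = (Finset.univ.filter fun w => w ∉ S ∧ pos (𝒯.par w) = p).card) →
        ∃ f, 𝒯.Graceful f) →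
      (∀ {S : Finset V} {f : V → ℤ} {l h d : ℤ}, 𝒯.Partial S f l h d → Pointers n P Q l h d →
        (∀ w, w ∉ S → 𝒯.par w ∈ S ∧ f (𝒯.par w) = zigzag n (pos (𝒯.par w))) →
        (∀ p, (Pi.single P 1 + c : ℤ → ℕ) p =
          (Finset.univ.filter fun w => w ∉ S ∧ pos (𝒯.par w) = p).card) →
        ∃ f, 𝒯.Graceful f) := by
    intro P Q Q' c hQ ih S f l h d H hPQ hpar hc
    have hne : (Finset.univ.filter fun w => w ∉ S ∧ pos (𝒯.par w) = P).Nonempty := by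
      rw [← Finset.card_pos, ← hc P]; simp
    obtain ⟨w, hw⟩ := hne
    obtain ⟨hwS, hwP⟩ : w ∉ S ∧ pos (𝒯.par w) = P := by simpa using hw
    obtain ⟨x, l', h', d', H', hPQ'⟩ :=
      H.exists_insert hPQ hwS (hpar w hwS).1 (by rw [(hpar w hwS).2, hwP]) hQ
    refine ih H' hPQ' ?_ ?_
    · intro w' hw'
      have hw'S : w' ∉ S := fun e => hw' (Finset.mem_insert_of_mem e)
      refine ⟨Finset.mem_insert_of_mem (hpar w' hw'S).1, ?_⟩
      rw [Function.update_of_ne, (hpar w' hw'S).2]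
      intro e
      exact hwS (e ▸ (hpar w' hw'S).1)
    · intro p
      have hcp := hc p
      have hE : (Finset.univ.filter fun u => u ∉ insert w S ∧ pos (𝒯.par u) = p) =
          (Finset.univ.filter fun u => u ∉ S ∧ pos (𝒯.par u) = p).erase w := by
        ext u; simp only [Finset.mem_filter, Finset.mem_univ, true_and, Finset.mem_insert,
          Finset.mem_erase]; tauto
      rw [hE]
      by_cases hp : p = P
      · subst hp
        rw [Finset.card_erase_of_mem (by simp [hwS, hwP]), ← hcp]
        simp
      · rw [Finset.erase_eq_of_notMem, ← hcp]
        · simp [Pi.single_eq_of_ne hp]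
        · simp only [Finset.mem_filter, Finset.mem_univ, true_and, not_and]
          intro _ e; exact hp (e ▸ hwP)
  induction hs with
  | done P Q =>
    intro S f l h d H _ _ hc
    refine ⟨f, H.graceful fun u => ?_⟩
    by_contra hu
    have := hc (pos (𝒯.par u))
    rw [Pi.zero_apply, eq_comm, Finset.card_eq_zero] at this
    have hu' : u ∈ (Finset.univ.filter fun w => w ∉ S ∧ pos (𝒯.par w) = pos (𝒯.par u)) := by
      simp [hu]
    rw [this] at hu'
    simp at hu'
  | symm _ ih =>
    intro S f l h d H hPQ hpar hc
    exact ih H hPQ.symm hpar hc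
  | forward _ ih =>
    intro S f l h d H hPQ hpar hc
    exact step (Or.inl rfl) ih H hPQ hpar hc
  | backward _ ih =>
    intro S f l h d H hPQ hpar hc
    exact step (Or.inr rfl) ih H hPQ hpar hc

end ParentTree

/-! ### Lattice paths and the order of the upper levels -/

/-- `LatticePath pos q L q'`: there is a path with steps `±1` from `q` to `q'` such that the `i`-th
step joins the heights `m` and `m + 1`, where `m` is the position of the `i`-th entry of `L`. -/
inductive LatticePath {V : Type*} (pos : V → ℤ) : ℤ → List V → ℤ → Prop
  | nil (q : ℤ) : LatticePath pos q [] q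
  | cons {q q₁ q' : ℤ} {u : V} {L : List V} :
      (pos u = q ∧ q₁ = q + 1 ∨ pos u = q₁ ∧ q = q₁ + 1) →
      LatticePath pos q₁ L q' → LatticePath pos q (u :: L) q'

lemma LatticePath.append {V : Type*} {pos : V → ℤ} {q q' q'' : ℤ} {L L' : List V}
    (h : LatticePath pos q L q') (h' : LatticePath pos q' L' q'') :
    LatticePath pos q (L ++ L') q'' := by
  induction h with
  | nil => exact h'
  | cons hu _ ih => exact .cons hu (ih h')

/-- An odd number of steps across the same edge lead upwards, if started below it. -/
lemma LatticePath.replicate_up {V : Type*} {pos : V → ℤ} {q : ℤ} {u : V} (hu : pos u = q) {k : ℕ}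
    (hk : Odd k) : LatticePath pos q (List.replicate k u) (q + 1) := by
  obtain ⟨m, rfl⟩ := hk
  induction m with
  | zero => exact .cons (.inl ⟨hu, rfl⟩) (.nil _)
  | succ m ih => exact .cons (.inl ⟨hu, rfl⟩) (.cons (.inr ⟨hu, rfl⟩) ih)

/-- An odd number of steps across the same edge lead downwards, if started above it. -/
lemma LatticePath.replicate_down {V : Type*} {pos : V → ℤ} {q : ℤ} {u : V} (hu : pos u = q)
    {k : ℕ} (hk : Odd k) : LatticePath pos (q + 1) (List.replicate k u) q := by
  obtain ⟨m, rfl⟩ := hk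
  induction m with
  | zero => exact .cons (.inr ⟨hu, rfl⟩) (.nil _)
  | succ m ih => exact .cons (.inr ⟨hu, rfl⟩) (.cons (.inl ⟨hu, rfl⟩) ih)

namespace ParentTree

variable {V : Type*} [Fintype V] [DecidableEq V] {𝒯 : ParentTree V}

/-- Following a lattice path, the vertices listed in `ws` are labelled along the zigzag. -/
lemma Partial.of_latticePath {f : V → ℤ} {pos : V → ℤ} {n q q' : ℤ} {P : List V}
    (hP : LatticePath pos q P q') :
    ∀ {L ws : List V}, P = ws.map 𝒯.par → (L ++ ws).Nodup →
      (∀ u ∈ L ++ ws, f u = zigzag n (pos u)) →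
      (∀ i (hi : i < (L ++ ws).length), pos (L ++ ws)[i] = i) →
      (∀ u, u ∉ L ++ ws → (L ++ ws).length ≤ pos u) →
      (L.length + 1 - q) % 2 = 0 →
      𝒯.Partial L.toFinset f ((L.length + 1) / 2) (n - L.length / 2) ((L.length + 1 - q) / 2) →
      ((L ++ ws).length + 1 - q') % 2 = 0 ∧
      𝒯.Partial (L ++ ws).toFinset f (((L ++ ws).length + 1) / 2) (n - (L ++ ws).length / 2)
        (((L ++ ws).length + 1 - q') / 2) := by
  induction hP with
  | nil q =>
    intro L ws hws _ _ _ _ hpar H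
    obtain rfl : ws = [] := by simpa using hws.symm
    rw [List.append_nil]
    exact ⟨hpar, H⟩
  | @cons q q₁ q' u P' hu _ ih =>
    intro L ws hws hnd hf hpos hout hpar H
    obtain ⟨w, ws, rfl, rfl, rfl⟩ := List.map_eq_cons_iff.1 hws.symm
    have hwL : w ∉ L := fun e => by
      rw [List.nodup_append] at hnd
      exact hnd.2.2 w e w (by simp) rfl
    have hpw : pos w = L.length := by
      have := hpos L.length (by simp)
      simpa using this
    have hdp := H.d_pos
    -- the height of the path is less than `L.length`, so the parent is already labelled
    have hparL : 𝒯.par w ∈ L := by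
      by_contra hc
      by_cases hc2 : 𝒯.par w ∈ L ++ w :: ws
      · obtain ⟨i, hi, he⟩ := List.getElem_of_mem hc2
        have h1 := hpos i hi
        rw [he] at h1
        have : i < L.length := by omega
        rw [List.getElem_append_left this] at he
        exact hc (he ▸ List.getElem_mem _)
      · have := hout _ hc2
        simp at this
        omega
    have hfw := hf w (by simp)
    have hfp := hf (𝒯.par w) (by simp [hparL])
    rw [hpw] at hfw
    unfold zigzag at hfw hfp
    have hwL' : w ∉ L.toFinset := by simpa using hwL
    have hlh := H.le_of_notMem hwL'
    have hlen : (((L ++ [w]).length : ℕ) : ℤ) = L.length + 1 := by simp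
    have e : (L ++ [w]).toFinset = Insert.insert w L.toFinset := by
      ext x; simp
    have H' : 𝒯.Partial (L ++ [w]).toFinset f (((L ++ [w]).length + 1) / 2)
        (n - (L ++ [w]).length / 2) (((L ++ [w]).length + 1 - q₁) / 2) := by
      rw [e, hlen]
      refine H.insert hwL' (by simpa using hparL) ?_ ?_
      · split_ifs at hfw <;> omega
      · rw [hfw, hfp]
        rcases hu with ⟨hu, hq⟩ | ⟨hu, hq⟩
        · refine Or.inr ⟨?_, by omega⟩
          split_ifs
          · omega
          · rw [abs_of_nonpos] <;> omega
          · rw [abs_of_nonneg] <;> omega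
          · omega
        · refine Or.inl ⟨?_, by omega⟩
          split_ifs
          · rw [abs_of_nonneg] <;> omega
          · omega
          · omega
          · rw [abs_of_nonpos] <;> omega
    have := ih (L := L ++ [w]) (ws := ws) rfl (by simpa using hnd)
      (by simpa using hf) (by simpa using hpos) (by simpa using hout) (by omega) H'
    rwa [List.append_assoc] at this

end ParentTree

/-- The entries of the list have the values `k, k + 1, …` under `pos`. -/
def PosFrom {V : Type*} (pos : V → ℤ) : ℤ → List V → Prop
  | _, [] => True
  | k, u :: l => pos u = k ∧ PosFrom pos (k + 1) l

lemma posFrom_append {V : Type*} {pos : V → ℤ} {k : ℤ} {l l' : List V} :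
    PosFrom pos k (l ++ l') ↔ PosFrom pos k l ∧ PosFrom pos (k + l.length) l' := by
  induction l generalizing k with
  | nil => simp [PosFrom]
  | cons u l ih =>
    have : k + 1 + (l.length : ℤ) = k + ((u :: l).length : ℤ) := by simp; omega
    simp only [List.cons_append, PosFrom, ih, this, and_assoc]

lemma posFrom_of_getElem {V : Type*} {pos : V → ℤ} {k : ℤ} {l : List V}
    (h : ∀ i (hi : i < l.length), pos l[i] = k + i) : PosFrom pos k l := by
  induction l generalizing k with
  | nil => trivial
  | cons u l ih =>
    refine ⟨by have := h 0 (by simp); simp only [List.getElem_cons_zero] at this; omega,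
      ih fun i hi => ?_⟩
    have := h (i + 1) (by simpa using hi)
    simp only [List.getElem_cons_succ] at this
    omega

/-- The function on `ℤ` with the values `k ↦ a₀, k + 1 ↦ a₁, …` listed, and `0` elsewhere. -/
def demand : ℤ → List ℕ → ℤ → ℕ
  | _, [] => 0
  | k, a :: l => Pi.single k a + demand (k + 1) l

lemma demand_map {V : Type*} {pos : V → ℤ} (g : V → ℕ) {k : ℤ} {l : List V}
    (h : PosFrom pos k l) (p : ℤ) :
    demand k (l.map g) p = (l.map fun u => if pos u = p then g u else 0).sum := by
  induction l generalizing k with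
  | nil => rfl
  | cons u l ih =>
    simp only [List.map_cons, demand, Pi.add_apply, List.sum_cons, ih h.2, h.1]
    by_cases hp : k = p
    · subst hp; simp
    · rw [Pi.single_eq_of_ne (Ne.symm hp), if_neg hp]

namespace ParentTree

variable {V : Type*} [Fintype V] [DecidableEq V] {𝒯 : ParentTree V}

/-- The upper levels are labelled along a lattice path, then the last level is served. The list
`pre ++ W` gives the zigzag order of the vertices above the last level; `W` is the level before the
last. -/
theorem exists_graceful_of_lists {j : ℕ} {pre W ws : List V} (hroot : 𝒯.root :: ws = pre ++ W)
    (hnd : (pre ++ W).Nodup) (hpre : ∀ u, u ∈ pre ↔ 𝒯.lev u < j) (hW : ∀ u, u ∈ W ↔ 𝒯.lev u = j)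
    (hmax : ∀ u, 𝒯.lev u ≤ j + 1)
    (hpath : ∀ pos : V → ℤ, PosFrom pos 0 pre → LatticePath pos 0 (ws.map 𝒯.par) pre.length)
    (hs : Serve pre.length (pre.length - 1) (demand pre.length (W.map 𝒯.deg))) :
    ∃ f, 𝒯.Graceful f := by
  set pos : V → ℤ := fun u => ((pre ++ W).idxOf u : ℤ) with hpos
  have hget : ∀ i (hi : i < (pre ++ W).length), pos (pre ++ W)[i] = i := fun i hi => by
    simp only [hpos]
    rw [List.Nodup.idxOf_getElem hnd]
  have hP : PosFrom pos 0 (pre ++ W) := posFrom_of_getElem (by simpa using hget)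
  obtain ⟨hP1, hP2⟩ := posFrom_append.1 hP
  rw [zero_add] at hP2
  have hpr : pos 𝒯.root = 0 := by
    rw [← hroot] at hP
    exact hP.1
  set n : ℤ := Fintype.card V - 1 with hn
  have hcard : 0 < Fintype.card V := Fintype.card_pos_iff.2 ⟨𝒯.root⟩
  set f : V → ℤ := fun u => zigzag n (pos u) with hf
  have hf0 : f 𝒯.root = 0 := by simp [hf, hpr, zigzag]
  -- at first, only the root is labelled
  have H0 : 𝒯.Partial [𝒯.root].toFinset f (([𝒯.root].length + 1) / 2) (n - [𝒯.root].length / 2)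
      (([𝒯.root].length + 1 - 0) / 2) := by
    have e : [𝒯.root].toFinset = {𝒯.root} := by simp
    rw [e]
    constructor <;> simp [hf0] <;> omega
  have hmem : ∀ u, u ∈ pre ++ W ↔ 𝒯.lev u ≤ j := fun u => by
    rw [List.mem_append, hpre, hW]; omega
  obtain ⟨hpar, H⟩ := Partial.of_latticePath (n := n) (f := f) (hpath pos hP1) (L := [𝒯.root])
    (ws := ws) rfl (by simpa [hroot] using hnd) (fun _ _ => rfl)
    (by simpa [hroot] using hget) (fun u hu => by
      rw [List.singleton_append, hroot] at hu ⊢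
      simp only [hpos]
      rw [List.idxOf_eq_length hu]) (by simp) H0
  rw [List.singleton_append, hroot] at hpar H
  refine exists_graceful_of_serve (n := n) hs pos H ?_ ?_ ?_
  · unfold Pointers zigzag
    split_ifs <;> omega
  · intro w hw
    rw [List.mem_toFinset, hmem] at hw
    have hwr : w ≠ 𝒯.root := by rintro rfl; rw [𝒯.lev_root] at hw; omega
    have := 𝒯.lev_par w hwr
    have := hmax w
    exact ⟨by rw [List.mem_toFinset, hmem]; omega, rfl⟩
  · intro p
    rw [demand_map _ hP2, ← List.sum_toFinset _ (List.nodup_append.1 hnd).2.1]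
    rw [Finset.card_eq_sum_card_fiberwise (f := 𝒯.par) (t := W.toFinset)]
    · refine Finset.sum_congr rfl fun u hu => ?_
      rw [List.mem_toFinset, hW] at hu
      split_ifs with hup
      · rw [deg]
        congr 1
        ext w
        simp only [Finset.mem_filter, Finset.mem_univ, true_and, List.mem_toFinset, hmem]
        constructor
        · intro hw
          have := 𝒯.lev_of_mem_kids hw
          obtain ⟨-, rfl⟩ := 𝒯.mem_kids.1 hw
          exact ⟨⟨by omega, hup⟩, rfl⟩
        · rintro ⟨⟨h1, -⟩, rfl⟩
          refine 𝒯.mem_kids.2 ⟨?_, rfl⟩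
          rintro rfl
          rw [𝒯.lev_root] at h1; omega
      · rw [eq_comm, Finset.card_eq_zero]
        ext w
        simp only [Finset.mem_filter, Finset.mem_univ, true_and, Finset.notMem_empty, iff_false]
        rintro ⟨⟨-, h2⟩, rfl⟩
        exact hup h2
    · intro w hw
      simp only [Finset.coe_filter, Finset.mem_univ, true_and, Set.mem_ofPred_eq, List.mem_toFinset,
        hmem] at hw
      have hwr : w ≠ 𝒯.root := by rintro rfl; rw [𝒯.lev_root] at hw; omega
      have := 𝒯.lev_par w hwr
      have := hmax w
      simp only [List.coe_toFinset, Set.mem_ofPred_eq, hW]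
      omega

end ParentTree

/-! ### Moves on the level before the last -/

namespace Serve

variable {P Q : ℤ} {c : ℤ → ℕ} {k : ℕ}

lemma take_even (hk : Even k) (h : Serve P Q c) : Serve P Q (Pi.single P k + c) := by
  obtain ⟨m, rfl⟩ := hk
  induction m with
  | zero => simpa using h
  | succ m ih =>
    have e : (Pi.single P (m + 1 + (m + 1)) : ℤ → ℕ) + c =
        Pi.single P 1 + (Pi.single P 1 + (Pi.single P (m + m) + c)) := by
      have e' : (Pi.single P (m + 1 + (m + 1)) : ℤ → ℕ) =
          Pi.single P 1 + (Pi.single P 1 + Pi.single P (m + m)) := by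
        rw [← Pi.single_add, ← Pi.single_add]
        congr 1; ring
      rw [e', add_assoc, add_assoc]
    rw [e]
    exact .forward (.backward (by rwa [add_sub_cancel_right]))

lemma take_odd_forward (hk : Odd k) (h : Serve P (Q + 2) c) : Serve P Q (Pi.single P k + c) := by
  obtain ⟨m, rfl⟩ := hk
  rw [add_comm (2 * m), Pi.single_add, add_assoc]
  exact .forward (take_even (even_two_mul m) h)

lemma take_odd_backward (hk : Odd k) (h : Serve P (Q - 2) c) :
    Serve P Q (Pi.single P k + c) := by
  obtain ⟨m, rfl⟩ := hk
  rw [add_comm (2 * m), Pi.single_add, add_assoc]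
  exact .backward (take_even (even_two_mul m) h)

lemma take_all (k : ℕ) : Serve P Q (Pi.single P k) := by
  rcases Nat.even_or_odd k with hk | hk
  · simpa using take_even hk (.done P Q)
  · simpa using take_odd_forward hk (.done P (Q + 2))

end Serve

/-- Serving the positions from `k` on, in one of two phases. In the phase `false`, the positions
are visited in their order. In the phase `true`, the two positions `k + 2 i` and `k + 2 i + 1` are
visited in the reverse order, for each `i`. -/
def ServeAt : Bool → ℤ → (ℤ → ℕ) → Prop
  | false, k, c => Serve k (k - 1) c
  | true, k, c => Serve (k + 1) (k - 2) c

lemma serveAt_zero (b : Bool) (k : ℤ) : ServeAt b k 0 := by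
  cases b <;> exact .done _ _

lemma ServeAt.odd {k : ℤ} {a : ℕ} {c : ℤ → ℕ} (ha : Odd a) (h : ServeAt false (k + 1) c) :
    ServeAt false k (Pi.single k a + c) := by
  refine Serve.take_odd_forward ha (.symm ?_)
  have e : k - 1 + 2 = k + 1 := by ring
  rw [e]
  simpa [ServeAt] using h

lemma ServeAt.odd_odd {b : Bool} {k : ℤ} {a a' : ℕ} {c : ℤ → ℕ} (ha : Odd a) (ha' : Odd a')
    (h : ServeAt b (k + 2) c) :
    ServeAt b k (Pi.single k a + (Pi.single (k + 1) a' + c)) := by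
  cases b
  · refine .odd ha (.odd ha' ?_)
    rwa [add_assoc]
  · rw [add_left_comm]
    refine Serve.take_odd_forward ha' (.symm ?_)
    rw [sub_add_cancel]
    refine Serve.take_odd_forward ha (.symm ?_)
    simp only [ServeAt, add_sub_cancel_right] at h
    rwa [add_right_comm] at h

/-- Two even numbers switch from the phase `false` to the phase `true`: the first vertex takes one
child, the second one all of its children, and the first one the rest. -/
lemma ServeAt.even_even_false {k : ℤ} {a a' : ℕ} {c : ℤ → ℕ} (ha : Even a) (ha0 : a ≠ 0)
    (ha' : Even a') (h : ServeAt true (k + 2) c) :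
    ServeAt false k (Pi.single k a + (Pi.single (k + 1) a' + c)) := by
  obtain ⟨m, rfl⟩ : ∃ m, a = 1 + m := ⟨a - 1, by omega⟩
  have hm : Odd m := by rw [add_comm, Nat.even_add_one, Nat.not_even_iff_odd] at ha; exact ha
  rw [Pi.single_add, add_assoc, add_left_comm (Pi.single k m : ℤ → ℕ)]
  refine Serve.take_odd_forward odd_one (.symm ?_)
  have e : k - 1 + 2 = k + 1 := by ring
  rw [e]
  refine Serve.take_even ha' (.symm (Serve.take_odd_forward hm (.symm ?_)))
  simp only [ServeAt, add_sub_cancel_right] at h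
  rwa [add_right_comm] at h

/-- Two even numbers switch from the phase `true` to the phase `false`. -/
lemma ServeAt.even_even_true {k : ℤ} {a a' : ℕ} {c : ℤ → ℕ} (ha : Even a)
    (ha' : Even a') (ha0 : a' ≠ 0) (h : ServeAt false (k + 2) c) :
    ServeAt true k (Pi.single k a + (Pi.single (k + 1) a' + c)) := by
  obtain ⟨m, rfl⟩ : ∃ m, a' = 1 + m := ⟨a' - 1, by omega⟩
  have hm : Odd m := by rw [add_comm, Nat.even_add_one, Nat.not_even_iff_odd] at ha'; exact ha'
  rw [Pi.single_add, add_assoc, add_left_comm]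
  refine Serve.take_odd_forward odd_one (.symm ?_)
  rw [sub_add_cancel]
  refine Serve.take_even ha (.symm (Serve.take_odd_forward hm (.symm ?_)))
  have e : k + 2 - 1 = k + 1 := by ring
  rwa [ServeAt, e] at h

lemma ServeAt.last {k : ℤ} (a : ℕ) : ServeAt false k (demand k [a]) := by
  simpa [demand, ServeAt] using Serve.take_all a

lemma ServeAt.odds {k : ℤ} {l l' : List ℕ} (hl : ∀ a ∈ l, Odd a)
    (hl' : ∀ k, ServeAt false k (demand k l')) : ServeAt false k (demand k (l ++ l')) := by
  induction l generalizing k with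
  | nil => exact hl' k
  | cons a l ih => exact .odd (hl a (by simp)) (ih fun x hx => hl x (by simp [hx]))

lemma demand_append (l l' : List ℕ) (k : ℤ) :
    demand k (l ++ l') = demand k l + demand (k + l.length) l' := by
  induction l generalizing k with
  | nil => simp [demand]
  | cons a l ih =>
    have : k + 1 + (l.length : ℤ) = k + ((a :: l).length : ℤ) := by simp; ring
    rw [List.cons_append, demand, ih, demand, this, add_assoc (Pi.single k a : ℤ → ℕ)]

lemma demand_zeros {l : List ℕ} (hl : ∀ a ∈ l, a = 0) (k : ℤ) : demand k l = 0 := by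
  induction l generalizing k with
  | nil => rfl
  | cons a l ih =>
    rw [demand, ih (fun x hx => hl x (by simp [hx])), hl a (by simp)]
    simp

/-- A run of positive even numbers: each vertex takes one child on the way forward and the rest on
the way back, so that the pointers return. -/
lemma ServeAt.evens {l : List ℕ} (hl : ∀ a ∈ l, Even a ∧ a ≠ 0) {k : ℤ} {c : ℤ → ℕ}
    (h : ServeAt false k c) : ServeAt false k (demand k l + c) := by
  induction l generalizing k c with
  | nil => simpa [demand] using h
  | cons a l ih =>
    obtain ⟨ha, ha0⟩ := hl a (by simp)
    obtain ⟨m, rfl⟩ : ∃ m, a = 1 + m := ⟨a - 1, by omega⟩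
    have hm : Odd m := by rw [add_comm, Nat.even_add_one, Nat.not_even_iff_odd] at ha; exact ha
    rw [demand, Pi.single_add, add_assoc, add_assoc, add_left_comm (Pi.single k m : ℤ → ℕ)]
    refine Serve.take_odd_forward odd_one (.symm ?_)
    have e : k - 1 + 2 = k + 1 := by ring
    rw [e]
    have := ih (fun x hx => hl x (by simp [hx])) (k := k + 1) (c := Pi.single k m + c) (by
      rw [ServeAt, add_sub_cancel_right]
      refine .symm (Serve.take_odd_backward hm ?_)
      have e' : k + 1 - 2 = k - 1 := by ring
      rw [e']
      exact h)
    rwa [ServeAt, add_sub_cancel_right] at this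

/-! ### Dominoes -/

/-- The list is a concatenation of pairs `[a, b]` with `R a b`. -/
inductive Paired {α : Type*} (R : α → α → Prop) : List α → Prop
  | nil : Paired R []
  | cons {a b : α} {l : List α} : R a b → Paired R l → Paired R (a :: b :: l)

namespace Paired

variable {α : Type*} {R : α → α → Prop}

lemma append {l l' : List α} (h : Paired R l) (h' : Paired R l') : Paired R (l ++ l') := by
  induction h with
  | nil => exact h'
  | cons hab _ ih => exact .cons hab ih

lemma reverse (hR : ∀ a b, R a b → R b a) {l : List α} (h : Paired R l) :
    Paired R l.reverse := by
  induction h with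
  | nil => exact .nil
  | cons hab _ ih =>
    simp only [List.reverse_cons, List.append_assoc, List.cons_append, List.nil_append]
    exact ih.append (.cons (hR _ _ hab) .nil)

lemma mono_mem {R' : α → α → Prop} {l : List α} (h : Paired R l)
    (hRR : ∀ a ∈ l, ∀ b ∈ l, R a b → R' a b) : Paired R' l := by
  induction h with
  | nil => exact .nil
  | cons hab _ ih =>
    exact .cons (hRR _ (by simp) _ (by simp) hab)
      (ih fun a ha b hb => hRR a (by simp [ha]) b (by simp [hb]))

end Paired

/-- A list of odd length of elements of two kinds: pair off elements of the same kind until a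
single one is left. -/
lemma exists_paired_of_odd {α : Type*} (c : α → Bool) : ∀ l : List α, Odd l.length →
    ∃ D x, l.Perm (D ++ [x]) ∧ Paired (fun a b => c a = c b) D
  | [], h => by simp at h
  | [x], _ => ⟨[], x, .refl _, .nil⟩
  | a :: b :: l, h => by
    obtain ⟨D, x, hp, hD⟩ := exists_paired_of_odd c l (by
      simpa [Nat.odd_add_one] using h)
    have hp' : (a :: b :: l).Perm (a :: b :: (D ++ [x])) := (hp.cons b).cons a
    by_cases hab : c a = c b
    · exact ⟨a :: b :: D, x, hp', .cons hab hD⟩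
    by_cases hax : c a = c x
    · refine ⟨a :: x :: D, b, hp'.trans ((List.Perm.cons a ?_)), .cons hax hD⟩
      calc (b :: (D ++ [x])).Perm (b :: x :: D) := (List.perm_append_singleton x D).cons b
        _ |>.Perm (x :: b :: D) := .swap _ _ _
        _ |>.Perm (x :: (D ++ [b])) := (List.perm_append_singleton b D).symm.cons x
    · have hbx : c b = c x := by
        cases h1 : c a <;> cases h2 : c b <;> cases h3 : c x <;> simp_all
      refine ⟨b :: x :: D, a, hp'.trans ?_, .cons hbx hD⟩
      calc (a :: b :: (D ++ [x])).Perm (a :: b :: x :: D) :=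
            ((List.perm_append_singleton x D).cons b).cons a
        _ |>.Perm (b :: x :: D ++ [a]) := (List.perm_append_singleton a (b :: x :: D)).symm

/-- A list of even length of elements of two kinds: pair off elements of the same kind until nothing
or one element of each kind is left. -/
lemma exists_paired_of_even {α : Type*} (c : α → Bool) (l : List α) (h : Even l.length) :
    (∃ D, l.Perm D ∧ Paired (fun a b => c a = c b) D) ∨
    ∃ a b D, l.Perm (a :: b :: D) ∧ c a = true ∧ c b = false ∧
      Paired (fun a b => c a = c b) D := by
  cases l with
  | nil => exact Or.inl ⟨[], .refl _, .nil⟩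
  | cons a l =>
    obtain ⟨D, x, hp, hD⟩ := exists_paired_of_odd c l (by
      simpa [Nat.even_add_one] using h)
    have hp' : (a :: l).Perm (a :: x :: D) :=
      (hp.trans (List.perm_append_singleton x D)).cons a
    cases h1 : c a <;> cases h2 : c x
    · exact Or.inl ⟨_, hp', .cons (h1.trans h2.symm) hD⟩
    · exact Or.inr ⟨x, a, D, hp'.trans (.swap _ _ _), h2, h1, hD⟩
    · exact Or.inr ⟨a, x, D, hp', h1, h2, hD⟩
    · exact Or.inl ⟨_, hp', .cons (h1.trans h2.symm) hD⟩

namespace ParentTree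

variable {V : Type*} [Fintype V] [DecidableEq V] (𝒯 : ParentTree V)

/-- Two vertices that may be served one after the other: both have an odd number of children, or
both have an even number of children and at most one of them is a leaf, and then the other one is a
sibling of it. -/
def Domino (a b : V) : Prop :=
  Odd (𝒯.deg a) ∧ Odd (𝒯.deg b) ∨
  Even (𝒯.deg a) ∧ Even (𝒯.deg b) ∧ (𝒯.deg a ≠ 0 ∧ 𝒯.deg b ≠ 0 ∨
    𝒯.par a = 𝒯.par b ∧ (𝒯.deg a ≠ 0 ∨ 𝒯.deg b ≠ 0))

/-- The number of vertices in the list with an even number of children. -/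
def evens (l : List V) : ℕ := l.countP fun u => Even (𝒯.deg u)

variable {𝒯}

lemma Domino.symm {a b : V} (h : 𝒯.Domino a b) : 𝒯.Domino b a := by
  unfold Domino at *
  rcases h with h | ⟨h1, h2, h | ⟨h3, h⟩⟩
  · exact Or.inl h.symm
  · exact Or.inr ⟨h2, h1, Or.inl h.symm⟩
  · exact Or.inr ⟨h2, h1, Or.inr ⟨h3.symm, h.symm⟩⟩

lemma domino_of_even_iff {a b : V} (h : Even (𝒯.deg a) ↔ Even (𝒯.deg b)) (ha : 𝒯.deg a ≠ 0)
    (hb : 𝒯.deg b ≠ 0) : 𝒯.Domino a b := by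
  by_cases h1 : Even (𝒯.deg a)
  · exact Or.inr ⟨h1, h.1 h1, Or.inl ⟨ha, hb⟩⟩
  · exact Or.inl ⟨Nat.not_even_iff_odd.1 h1, Nat.not_even_iff_odd.1 (h1 ∘ h.2)⟩

@[simp] lemma evens_nil : 𝒯.evens [] = 0 := rfl

lemma evens_append (l l' : List V) : 𝒯.evens (l ++ l') = 𝒯.evens l + 𝒯.evens l' := by
  simp [evens]

lemma evens_cons (a : V) (l : List V) :
    𝒯.evens (a :: l) = 𝒯.evens l + if Even (𝒯.deg a) then 1 else 0 := by
  simp [evens, List.countP_cons]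

lemma evens_even {D : List V} (h : Paired 𝒯.Domino D) : Even (𝒯.evens D) := by
  induction h with
  | nil => simp
  | cons hab _ ih =>
    rw [evens_cons, evens_cons]
    rcases hab with ⟨h1, h2⟩ | ⟨h1, h2, -⟩
    · rw [if_neg (Nat.not_even_iff_odd.2 h1), if_neg (Nat.not_even_iff_odd.2 h2)]
      exact ih
    · rw [if_pos h1, if_pos h2]
      exact (ih.add even_two)

/-- A list of dominoes can be served, after exchanging siblings if necessary: in each even domino,
the vertex visited first must not be a leaf. Each even domino switches the phase. -/
lemma exists_serveAt_of_dominoes {D : List V} (h : Paired 𝒯.Domino D) (b : Bool) :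
    ∃ D' : List V, D'.Perm D ∧ D'.map 𝒯.par = D.map 𝒯.par ∧
      ∀ k c, ServeAt (b ^^ decide (𝒯.evens D % 4 = 2)) (k + D.length) c →
        ServeAt b k (demand k (D'.map 𝒯.deg) + c) := by
  induction h generalizing b with
  | nil => exact ⟨[], .refl _, rfl, fun k c hc => by simpa [demand] using hc⟩
  | @cons x y l hxy hl ih =>
    have hev := evens_even hl
    have hlen : ∀ k : ℤ, k + ((x :: y :: l).length : ℤ) = k + 2 + l.length := fun k => by simp; ring
    rcases hxy with ⟨h1, h2⟩ | ⟨h1, h2, h3⟩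
    · obtain ⟨D', hp, hm, hs⟩ := ih b
      refine ⟨x :: y :: D', (hp.cons y).cons x, by simp [hm], fun k c hc => ?_⟩
      simp only [List.map_cons, demand, add_assoc]
      refine .odd_odd h1 h2 (hs _ c ?_)
      rw [hlen, evens_cons, evens_cons, if_neg (Nat.not_even_iff_odd.2 h1),
        if_neg (Nat.not_even_iff_odd.2 h2)] at hc
      exact hc
    · have hphase : (b ^^ decide (𝒯.evens (x :: y :: l) % 4 = 2)) =
          (!b ^^ decide (𝒯.evens l % 4 = 2)) := by
        rw [evens_cons, evens_cons, if_pos h1, if_pos h2]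
        have : 𝒯.evens l % 4 = 0 ∨ 𝒯.evens l % 4 = 2 := by
          have := Nat.even_iff.1 hev; omega
        rcases this with h | h
        · have h' : (𝒯.evens l + 1 + 1) % 4 = 2 := by omega
          simp [h, h']
        · have h' : (𝒯.evens l + 1 + 1) % 4 = 0 := by omega
          simp [h, h']
      rw [hphase]
      obtain ⟨D', hp, hm, hs⟩ := ih (!b)
      -- `u` is served first
      have main : ∃ u w, (u = x ∧ w = y ∨ u = y ∧ w = x) ∧
          [u, w].map 𝒯.par = [x, y].map 𝒯.par ∧ 𝒯.deg (if b then w else u) ≠ 0 := by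
        rcases h3 with ⟨h3, h4⟩ | ⟨h3, h4⟩
        · exact ⟨x, y, Or.inl ⟨rfl, rfl⟩, rfl, by cases b <;> simpa⟩
        · by_cases h5 : 𝒯.deg (if b then y else x) ≠ 0
          · exact ⟨x, y, Or.inl ⟨rfl, rfl⟩, rfl, h5⟩
          · refine ⟨y, x, Or.inr ⟨rfl, rfl⟩, by simp [h3], ?_⟩
            cases b <;> simp_all
      obtain ⟨u, w, huw, hpar, hne⟩ := main
      refine ⟨u :: w :: D', ?_, ?_, fun k c hc => ?_⟩
      · rcases huw with ⟨rfl, rfl⟩ | ⟨rfl, rfl⟩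
        · exact (hp.cons _).cons _
        · exact ((hp.cons _).cons _).trans (.swap _ _ _)
      · simp only [List.map_cons, List.map_nil, List.cons.injEq, and_true] at hpar
        simp [hm, hpar]
      · have hu : Even (𝒯.deg u) ∧ Even (𝒯.deg w) := by
          rcases huw with ⟨rfl, rfl⟩ | ⟨rfl, rfl⟩ <;> exact ⟨by assumption, by assumption⟩
        rw [hlen] at hc
        simp only [List.map_cons, demand, add_assoc]
        cases b
        · exact .even_even_false hu.1 (by simpa using hne) hu.2 (hs _ c hc)
        · exact .even_even_true hu.1 hu.2 (by simpa using hne) (hs _ c hc)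

end ParentTree

namespace ParentTree

variable {V : Type*} [Fintype V] [DecidableEq V] (𝒯 : ParentTree V)

/-! ### Orders of the levels -/

/-- `l'` lists the children of the vertices in `l`, first those of the first vertex, and so on. -/
inductive Step : List V → List V → Prop
  | nil : Step [] []
  | cons {u : V} {c l l' : List V} :
      c.Perm (𝒯.kids u).toList → Step l l' → Step (u :: l) (c ++ l')

/-- `W` arises from `l` by `m` steps to the next level. -/
inductive Reach : ℕ → List V → List V → Prop
  | zero (l : List V) : Reach 0 l l
  | succ {m : ℕ} {l l' W : List V} : 𝒯.Step l l' → Reach m l' W → Reach (m + 1) l W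

variable {𝒯}

lemma Step.append {l₁ l₂ l₁' l₂' : List V} (h₁ : 𝒯.Step l₁ l₁') (h₂ : 𝒯.Step l₂ l₂') :
    𝒯.Step (l₁ ++ l₂) (l₁' ++ l₂') := by
  induction h₁ with
  | nil => exact h₂
  | cons hc _ ih => rw [List.append_assoc]; exact .cons hc ih

lemma Step.single {u : V} {c : List V} (hc : c.Perm (𝒯.kids u).toList) : 𝒯.Step [u] c := by
  simpa using Step.cons hc .nil

lemma Step.reverse {l l' : List V} (h : 𝒯.Step l l') : 𝒯.Step l.reverse l'.reverse := by
  induction h with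
  | nil => exact .nil
  | cons hc _ ih =>
    rw [List.reverse_cons, List.reverse_append]
    exact ih.append (.single ((List.reverse_perm _).trans hc))

lemma Reach.append {m : ℕ} {l₁ l₂ W₁ W₂ : List V} (h₁ : 𝒯.Reach m l₁ W₁)
    (h₂ : 𝒯.Reach m l₂ W₂) : 𝒯.Reach m (l₁ ++ l₂) (W₁ ++ W₂) := by
  induction h₁ generalizing l₂ with
  | zero => cases h₂; exact .zero _
  | succ hs _ ih =>
    cases h₂ with
    | succ hs' h₂ => exact .succ (hs.append hs') (ih h₂)

lemma Reach.reverse {m : ℕ} {l W : List V} (h : 𝒯.Reach m l W) :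
    𝒯.Reach m l.reverse W.reverse := by
  induction h with
  | zero => exact .zero _
  | succ hs _ ih => exact .succ hs.reverse ih

lemma Reach.one {u : V} {c : List V} (hc : c.Perm (𝒯.kids u).toList) : 𝒯.Reach 1 [u] c :=
  .succ (.single hc) (.zero _)

lemma Reach.of_kids {m : ℕ} {u : V} {c W : List V} (hc : c.Perm (𝒯.kids u).toList)
    (h : 𝒯.Reach m c W) : 𝒯.Reach (m + 1) [u] W :=
  .succ (.single hc) h

lemma Step.mem {l l' : List V} (h : 𝒯.Step l l') (w : V) :
    w ∈ l' ↔ w ≠ 𝒯.root ∧ 𝒯.par w ∈ l := by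
  induction h with
  | nil => simp
  | cons hc _ ih =>
    rw [List.mem_append, ih, hc.mem_iff, Finset.mem_toList, mem_kids, List.mem_cons]
    tauto

lemma Step.nodup {l l' : List V} (h : 𝒯.Step l l') (hl : l.Nodup) : l'.Nodup := by
  induction h with
  | nil => exact hl
  | cons hc hs ih =>
    rw [List.nodup_cons] at hl
    rw [List.nodup_append]
    refine ⟨hc.nodup_iff.2 (Finset.nodup_toList _), ih hl.2, ?_⟩
    rintro a ha b hb rfl
    rw [hc.mem_iff, Finset.mem_toList, mem_kids] at ha
    rw [hs.mem] at hb
    exact hl.1 (ha.2 ▸ hb.2)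

/-- If all vertices in the list have an odd number of children, then these can be labelled
following a path that leads upwards. -/
lemma Step.latticePath {l l' : List V} (h : 𝒯.Step l l') (hodd : ∀ u ∈ l, Odd (𝒯.deg u))
    {pos : V → ℤ} {k : ℤ} (hpos : PosFrom pos k l) :
    LatticePath pos k (l'.map 𝒯.par) (k + l.length) := by
  induction h generalizing k with
  | nil => simpa using LatticePath.nil k
  | @cons u c l l' hc _ ih =>
    have e : k + ((u :: l).length : ℤ) = k + 1 + l.length := by simp; ring
    have ec : c.map 𝒯.par = List.replicate c.length u := by
      rw [List.eq_replicate_iff]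
      refine ⟨by simp, fun x hx => ?_⟩
      obtain ⟨w, hw, rfl⟩ := List.mem_map.1 hx
      rw [hc.mem_iff, Finset.mem_toList, mem_kids] at hw
      exact hw.2
    have hlen : Odd c.length := by
      rw [hc.length_eq, Finset.length_toList]
      exact hodd u (by simp)
    rw [List.map_append, ec, e]
    exact (LatticePath.replicate_up hpos.1 hlen).append
      (ih (fun u hu => hodd u (by simp [hu])) hpos.2)

lemma Reach.exists_latticePath {m : ℕ} {l W : List V} (h : 𝒯.Reach m l W) :
    ∀ i, l.Nodup → (∀ u, u ∈ l ↔ 𝒯.lev u = i) →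
      (∀ u, 𝒯.lev u < i + m → Odd (𝒯.deg u)) →
      ∃ pre ws, l ++ ws = pre ++ W ∧ pre.Nodup ∧ W.Nodup ∧
        (∀ u, u ∈ pre ↔ i ≤ 𝒯.lev u ∧ 𝒯.lev u < i + m) ∧ (∀ u, u ∈ W ↔ 𝒯.lev u = i + m) ∧
        ∀ (pos : V → ℤ) (k : ℤ), PosFrom pos k pre →
          LatticePath pos k (ws.map 𝒯.par) (k + pre.length) := by
  induction h with
  | zero l =>
    intro i hnd hl _
    refine ⟨[], [], by simp, by simp, hnd, fun u => ?_, by simpa using hl, fun pos k _ => ?_⟩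
    · simp
    · simpa using LatticePath.nil k
  | @succ m l l' W hs _ ih =>
    intro i hnd hl hodd
    have hl' : ∀ u, u ∈ l' ↔ 𝒯.lev u = i + 1 := fun u => by
      rw [hs.mem, hl]
      constructor
      · rintro ⟨h1, h2⟩; rw [← 𝒯.lev_par u h1, h2]
      · intro h1
        have hu : u ≠ 𝒯.root := by rintro rfl; rw [𝒯.lev_root] at h1; omega
        have := 𝒯.lev_par u hu
        exact ⟨hu, by omega⟩
    obtain ⟨pre, ws, he, hnd1, hnd2, hpre, hW, hp⟩ := ih (i + 1) (hs.nodup hnd) hl'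
      fun u hu => hodd u (by omega)
    refine ⟨l ++ pre, l' ++ ws, by rw [he]; simp, ?_, hnd2, ?_, ?_, ?_⟩
    · rw [List.nodup_append]
      refine ⟨hnd, hnd1, ?_⟩
      rintro a ha b hb rfl
      rw [hl] at ha
      rw [hpre] at hb
      omega
    · intro u
      rw [List.mem_append, hl, hpre]
      omega
    · intro u
      rw [hW]
      omega
    · intro pos k hpos
      rw [posFrom_append] at hpos
      rw [List.map_append, List.length_append]
      have := (hs.latticePath (fun u hu => hodd u (by rw [(hl u).1 hu]; omega)) hpos.1).append
        (hp pos _ hpos.2)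
      push_cast
      rwa [← add_assoc]

lemma Reach.exists_latticePath_root {m : ℕ} {W : List V} (h : 𝒯.Reach m [𝒯.root] W)
    (hodd : ∀ u, 𝒯.lev u < m → Odd (𝒯.deg u)) :
    ∃ pre ws, 𝒯.root :: ws = pre ++ W ∧ pre.Nodup ∧ W.Nodup ∧
      (∀ u, u ∈ pre ↔ 𝒯.lev u < m) ∧ (∀ u, u ∈ W ↔ 𝒯.lev u = m) ∧
      ∀ (pos : V → ℤ), PosFrom pos 0 pre →
        LatticePath pos 0 (ws.map 𝒯.par) pre.length := by
  obtain ⟨pre, ws, he, h1, h2, h3, h4, h5⟩ := h.exists_latticePath 0 (by simp)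
    (fun u => by
      rw [List.mem_singleton]
      exact ⟨fun e => e ▸ 𝒯.lev_root, 𝒯.eq_root_of_lev⟩) (by simpa using hodd)
  exact ⟨pre, ws, he, h1, h2, by simpa using h3, by simpa using h4,
    fun pos hp => by simpa using h5 pos 0 hp⟩

/-- If all vertices above the level `j` have an odd number of children, and if the list `W` of the
level `j` is rearranged without changing the sequence of parents such that it can be served, then
there is a graceful labeling. -/
lemma Reach.exists_graceful {j : ℕ} {W W' : List V} (h : 𝒯.Reach j [𝒯.root] W)
    (hodd : ∀ u, 𝒯.lev u < j → Odd (𝒯.deg u)) (hmax : ∀ u, 𝒯.lev u ≤ j + 1)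
    (hperm : W'.Perm W) (hpar : W'.map 𝒯.par = W.map 𝒯.par)
    (hs : ∀ k, ServeAt false k (demand k (W'.map 𝒯.deg))) : ∃ f, 𝒯.Graceful f := by
  obtain ⟨pre, ws, he, h1, h2, h3, h4, h5⟩ := h.exists_latticePath_root hodd
  have hnd : (pre ++ W').Nodup := by
    rw [List.nodup_append]
    refine ⟨h1, hperm.nodup_iff.2 h2, ?_⟩
    rintro a ha b hb rfl
    rw [h3] at ha
    rw [hperm.mem_iff, h4] at hb
    omega
  have hW : ∀ u, u ∈ W' ↔ 𝒯.lev u = j := fun u => by rw [hperm.mem_iff, h4]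
  obtain ⟨ws', he', hws'⟩ : ∃ ws', 𝒯.root :: ws' = pre ++ W' ∧
      ws'.map 𝒯.par = ws.map 𝒯.par := by
    cases pre with
    | nil =>
      cases h with
      | zero =>
        rw [List.perm_singleton] at hperm
        subst hperm
        exact ⟨ws, he, rfl⟩
      | succ =>
        have := (h3 𝒯.root).2 (by rw [𝒯.lev_root]; omega)
        simp at this
    | cons u pre =>
      simp only [List.cons_append, List.cons.injEq] at he
      refine ⟨pre ++ W', by rw [he.1]; rfl, ?_⟩
      rw [he.2, List.map_append, List.map_append, hpar]
  exact exists_graceful_of_lists he' hnd h3 hW hmax (fun pos hp => hws' ▸ h5 pos hp)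
    (hs pre.length)

variable (𝒯) in
/-- The number of vertices of level `j` with an even number of children. -/
def evensAt (j : ℕ) : ℕ := (Finset.univ.filter fun u => 𝒯.lev u = j ∧ Even (𝒯.deg u)).card

lemma Reach.evens_eq {j : ℕ} {W : List V} (h : 𝒯.Reach j [𝒯.root] W)
    (hodd : ∀ u, 𝒯.lev u < j → Odd (𝒯.deg u)) : 𝒯.evens W = 𝒯.evensAt j := by
  obtain ⟨pre, ws, -, -, h2, -, h4, -⟩ := h.exists_latticePath_root hodd
  rw [evens, List.countP_eq_length_filter, evensAt,
    ← List.toFinset_card_of_nodup (h2.filter _)]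
  congr 1
  ext u
  simp [h4]

/-! ### Arranging a level in dominoes -/

/-- The vertices `m` levels below `u` can be listed as a list `D` of dominoes, followed by a single
vertex `x` that is not a leaf. -/
def Arranged (𝒯 : ParentTree V) (m : ℕ) (u : V) (D : List V) (x : V) : Prop :=
  𝒯.Reach m [u] (D ++ [x]) ∧ Paired 𝒯.Domino D ∧ 𝒯.deg x ≠ 0

lemma Arranged.reach_reverse {m : ℕ} {u x : V} {D : List V} (h : 𝒯.Arranged m u D x) :
    𝒯.Reach m [u] (x :: D.reverse) := by
  simpa using h.1.reverse

/-- Vertices whose single remaining vertices `x` agree in parity are combined in pairs: the second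
list is reversed, so that the remaining vertices form another domino. -/
lemma exists_reach_of_paired {m : ℕ} {D : V → List V} {x : V → V} {L : List V}
    (hL : Paired (fun a b => decide (Even (𝒯.deg (x a))) = decide (Even (𝒯.deg (x b)))) L)
    (h : ∀ w ∈ L, 𝒯.Arranged m w (D w) (x w)) :
    ∃ W, 𝒯.Reach m L W ∧ Paired 𝒯.Domino W := by
  induction hL with
  | nil =>
    refine ⟨[], ?_, .nil⟩
    clear h
    induction m with
    | zero => exact .zero _
    | succ m ih => exact .succ .nil ih
  | @cons a b l hab _ ih =>
    obtain ⟨W, hW, hWD⟩ := ih fun w hw => h w (by simp [hw])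
    have ha := h a (by simp)
    have hb := h b (by simp)
    refine ⟨(D a ++ [x a]) ++ ((x b :: (D b).reverse) ++ W),
      ha.1.append (hb.reach_reverse.append hW), ?_⟩
    simp only [List.append_assoc, List.cons_append, List.nil_append]
    refine ha.2.1.append (.cons (domino_of_even_iff ?_ ha.2.2 hb.2.2)
      ((hb.2.1.reverse fun _ _ => Domino.symm).append hWD))
    simpa using hab

/-- Vertices other than leaves form a domino as soon as they agree in parity; of an odd number of
them, a single one is left. -/
lemma exists_dominoes_of_odd {l : List V} (hl : Odd l.length) (h0 : ∀ u ∈ l, 𝒯.deg u ≠ 0) :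
    ∃ D x, l.Perm (D ++ [x]) ∧ Paired 𝒯.Domino D ∧ 𝒯.deg x ≠ 0 := by
  obtain ⟨D, x, hp, hD⟩ := exists_paired_of_odd (fun u => decide (Even (𝒯.deg u))) l hl
  have h0' : ∀ u ∈ D ++ [x], 𝒯.deg u ≠ 0 := fun u hu => h0 u (hp.mem_iff.2 hu)
  refine ⟨D, x, hp, hD.mono_mem fun a ha b hb hab => ?_, h0' x (by simp)⟩
  exact domino_of_even_iff (by simpa using hab) (h0' a (by simp [ha])) (h0' b (by simp [hb]))

variable (𝒯) in
/-- Each leaf of level `j` has a sibling with an even, positive number of children, and no other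
sibling of it is a leaf. -/
def LeafCondition (j : ℕ) : Prop :=
  ∀ z, 𝒯.lev z = j → 𝒯.deg z = 0 →
    (∃ e, e ∈ 𝒯.kids (𝒯.par z) ∧ Even (𝒯.deg e) ∧ 𝒯.deg e ≠ 0) ∧
    ∀ w ∈ 𝒯.kids (𝒯.par z), w ≠ z → 𝒯.deg w ≠ 0

lemma exists_arranged {j : ℕ} (hodd : ∀ u, 𝒯.lev u < j → Odd (𝒯.deg u))
    (hleaf : 𝒯.LeafCondition j) (m : ℕ) :
    ∀ u, 𝒯.lev u + (m + 1) = j → ∃ D x, 𝒯.Arranged (m + 1) u D x := by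
  induction m with
  | zero =>
    intro u hu
    have hlen : Odd (𝒯.kids u).toList.length := by
      rw [Finset.length_toList]; exact hodd u (by omega)
    by_cases h0 : ∀ w ∈ (𝒯.kids u).toList, 𝒯.deg w ≠ 0
    · obtain ⟨D, x, hp, hD, hx⟩ := exists_dominoes_of_odd hlen h0
      exact ⟨D, x, .one hp.symm, hD, hx⟩
    · push Not at h0
      obtain ⟨z, hz, hz0⟩ := h0
      rw [Finset.mem_toList] at hz
      have hzu := (𝒯.mem_kids.1 hz).2
      obtain ⟨⟨e, he, he1, he0⟩, huniq⟩ := hleaf z (by rw [𝒯.lev_of_mem_kids hz, hu]) hz0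
      rw [hzu] at he huniq
      have hez : e ≠ z := by rintro rfl; exact he0 hz0
      -- the leaf is paired with its sibling `e`
      have hp : (𝒯.kids u).toList.Perm (e :: z :: ((𝒯.kids u).toList.erase e).erase z) := by
        refine (List.perm_cons_erase (by simpa using he)).trans (.cons e ?_)
        exact List.perm_cons_erase ((List.mem_erase_of_ne hez.symm).2 (by simpa using hz))
      have hnd : (e :: z :: ((𝒯.kids u).toList.erase e).erase z).Nodup :=
        hp.nodup_iff.1 (Finset.nodup_toList _)
      obtain ⟨D, x, hp', hD, hx⟩ := exists_dominoes_of_odd (𝒯 := 𝒯)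
        (l := ((𝒯.kids u).toList.erase e).erase z)
        (by have := hp.length_eq; rw [this] at hlen; simpa [Nat.odd_add_one] using hlen)
        (fun w hw => huniq w (by rw [← Finset.mem_toList, hp.mem_iff]; simp [hw]) (by
          rintro rfl
          simp [hw] at hnd))
      refine ⟨e :: z :: D, x, .one (hp.trans ((hp'.cons z).cons e)).symm, .cons ?_ hD, hx⟩
      exact Or.inr ⟨he1, by simp [hz0], Or.inr ⟨by rw [hzu, (𝒯.mem_kids.1 he).2], Or.inl he0⟩⟩
  | succ m ih =>
    intro u hu
    choose! D x hDx using ih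
    have hk : ∀ w ∈ 𝒯.kids u, 𝒯.Arranged (m + 1) w (D w) (x w) := fun w hw =>
      hDx w (by rw [𝒯.lev_of_mem_kids hw]; omega)
    obtain ⟨L, y, hp, hL⟩ := exists_paired_of_odd (fun a => decide (Even (𝒯.deg (x a))))
      (𝒯.kids u).toList (by rw [Finset.length_toList]; exact hodd u (by omega))
    have hk' : ∀ w ∈ L ++ [y], 𝒯.Arranged (m + 1) w (D w) (x w) := fun w hw =>
      hk w (by rw [← Finset.mem_toList, hp.mem_iff]; exact hw)
    obtain ⟨W, hW, hWD⟩ := exists_reach_of_paired hL fun w hw => hk' w (by simp [hw])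
    have hy := hk' y (by simp)
    exact ⟨W ++ D y, x y, .of_kids hp.symm (by rw [List.append_assoc]; exact hW.append hy.1),
      hWD.append hy.2.1, hy.2.2⟩

/-- If the number of vertices of level `j` with an even number of children is even, then the
remaining vertex has an odd number of children and is served first, after which the phase does not
matter. If it is `1` modulo `4`, then the phase is `false` after the dominoes, as it has to be for
the remaining vertex to be served last. -/
theorem exists_graceful_of_evensAt_mod_four {j : ℕ} (hodd : ∀ u, 𝒯.lev u < j → Odd (𝒯.deg u))
    (hmax : ∀ u, 𝒯.lev u ≤ j + 1) (hleaf : 1 ≤ j → 𝒯.LeafCondition j)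
    (hp : 𝒯.evensAt j % 4 ≠ 3) : ∃ f, 𝒯.Graceful f := by
  rcases j with _ | m
  · exact Reach.exists_graceful (.zero _) hodd hmax (.refl _) rfl fun k => .last _
  obtain ⟨D, x, hR, hD, hx⟩ := exists_arranged hodd (hleaf (by omega)) m 𝒯.root
    (by rw [𝒯.lev_root, zero_add])
  have hev := hR.evens_eq hodd
  rw [evens_append, evens_cons, evens_nil] at hev
  have hDe := evens_even hD
  by_cases hxe : Even (𝒯.deg x)
  · rw [if_pos hxe] at hev
    obtain ⟨D', hp', hm, hs⟩ := exists_serveAt_of_dominoes hD false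
    refine hR.exists_graceful hodd hmax (hp'.append_right [x]) (by simp [hm]) fun k => ?_
    rw [List.map_append, demand_append]
    refine hs k _ ?_
    have h4 : 𝒯.evens D % 4 ≠ 2 := by
      rw [Nat.even_iff] at hDe; omega
    simp only [h4, decide_false, Bool.xor_false]
    rw [List.length_map, hp'.length_eq]
    exact .last _
  · have hD' := hD.reverse fun _ _ => Domino.symm
    obtain ⟨D', hp', hm, hs⟩ := exists_serveAt_of_dominoes hD' false
    have hR' := hR.reverse
    refine Reach.exists_graceful (W := x :: D.reverse) (W' := x :: D') (by simpa using hR')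
      hodd hmax (hp'.cons x) (by simp [hm]) fun k => ?_
    rw [List.map_cons, demand]
    refine .odd (Nat.not_even_iff_odd.1 hxe) ?_
    simpa using hs (k + 1) 0 (serveAt_zero _ _)

/-! ### Three levels, with a leaf on the level before the last -/

/-- Let the number of vertices of level `2` with an even number of children be `3` modulo `4`, and
let `z` be a leaf of this level. Then either `z` or the domino formed by `z` and a sibling with an
odd number of children can be put last. -/
lemma exists_graceful_of_leaf (hodd : ∀ u, 𝒯.lev u < 2 → Odd (𝒯.deg u))
    (hmax : ∀ u, 𝒯.lev u ≤ 3) (hleaf : 𝒯.LeafCondition 2) (hp : 𝒯.evensAt 2 % 4 = 3) {z : V}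
    (hz : 𝒯.lev z = 2) (hz0 : 𝒯.deg z = 0) : ∃ f, 𝒯.Graceful f := by
  have hzr : z ≠ 𝒯.root := by rintro rfl; rw [𝒯.lev_root] at hz; omega
  have hlevZ : 𝒯.lev (𝒯.par z) = 1 := by have := 𝒯.lev_par z hzr; omega
  have hZr : 𝒯.par z ≠ 𝒯.root := fun e => by rw [e, 𝒯.lev_root] at hlevZ; omega
  have hZmem : 𝒯.par z ∈ 𝒯.kids 𝒯.root := by
    refine 𝒯.mem_kids.2 ⟨hZr, 𝒯.eq_root_of_lev ?_⟩
    have := 𝒯.lev_par _ hZr; omega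
  have hDx := exists_arranged hodd hleaf 0
  choose! D x hDx using hDx
  -- the order of the children of `𝒯.par z`
  have hZ : ∃ WZ, 𝒯.Reach 1 [𝒯.par z] WZ ∧
      ((∃ D', WZ = D' ++ [z] ∧ Paired 𝒯.Domino D') ∨
        ∃ e D' o, WZ = e :: (D' ++ [z, o]) ∧ Even (𝒯.deg e) ∧ 𝒯.deg e ≠ 0 ∧
          Odd (𝒯.deg o) ∧ Paired 𝒯.Domino D') := by
    have hzm : z ∈ (𝒯.kids (𝒯.par z)).toList := by simp [mem_kids, hzr]
    have hperm := List.perm_cons_erase hzm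
    have hlen : Odd (𝒯.kids (𝒯.par z)).toList.length := by
      rw [Finset.length_toList]; exact hodd _ (by omega)
    have hnd := hperm.nodup_iff.1 (Finset.nodup_toList _)
    have h0 : ∀ w ∈ (𝒯.kids (𝒯.par z)).toList.erase z, 𝒯.deg w ≠ 0 := fun w hw =>
      (hleaf z hz hz0).2 w (by rw [← Finset.mem_toList]; exact List.mem_of_mem_erase hw) (by
        rintro rfl; simp [hw] at hnd)
    rw [hperm.length_eq, List.length_cons, Nat.odd_add_one, Nat.not_odd_iff_even] at hlen
    rcases exists_paired_of_even (fun u => decide (Even (𝒯.deg u))) _ hlen with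
      ⟨D', hp', hD'⟩ | ⟨e, o, D', hp', he, ho, hD'⟩
    · refine ⟨D' ++ [z], .one ?_, Or.inl ⟨D', rfl, hD'.mono_mem fun a ha b hb hab => ?_⟩⟩
      · exact (List.perm_append_singleton z D').trans ((hperm.trans (hp'.cons z)).symm)
      · exact domino_of_even_iff (by simpa using hab) (h0 a (hp'.mem_iff.2 ha))
          (h0 b (hp'.mem_iff.2 hb))
    · refine ⟨e :: (D' ++ [z, o]), .one ?_, Or.inr ⟨e, D', o, rfl, by simpa using he,
        h0 e (hp'.mem_iff.2 (by simp)), by simpa using ho,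
        hD'.mono_mem fun a ha b hb hab => ?_⟩⟩
      · refine List.Perm.trans ?_ (hperm.trans (hp'.cons z)).symm
        calc (e :: (D' ++ [z, o])).Perm (e :: ([z, o] ++ D')) := List.perm_append_comm.cons e
          _ |>.Perm (z :: e :: o :: D') := .swap _ _ _
      · exact domino_of_even_iff (by simpa using hab) (h0 a (hp'.mem_iff.2 (by simp [ha])))
          (h0 b (hp'.mem_iff.2 (by simp [hb])))
  -- the order of the other children of the root, and of their children
  have hO : ∃ LO WO, LO.Perm ((𝒯.kids 𝒯.root).toList.erase (𝒯.par z)) ∧ 𝒯.Reach 1 LO WO ∧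
      (Paired 𝒯.Domino WO ∨ ∃ o D' e, WO = o :: (D' ++ [e]) ∧ Odd (𝒯.deg o) ∧
        Even (𝒯.deg e) ∧ 𝒯.deg e ≠ 0 ∧ Paired 𝒯.Domino D') := by
    have hperm := List.perm_cons_erase (Finset.mem_toList.2 hZmem)
    have hlen : Odd (𝒯.kids 𝒯.root).toList.length := by
      rw [Finset.length_toList]; exact hodd _ (by rw [𝒯.lev_root]; omega)
    rw [hperm.length_eq, List.length_cons, Nat.odd_add_one, Nat.not_odd_iff_even] at hlen
    have harr : ∀ w ∈ (𝒯.kids 𝒯.root).toList.erase (𝒯.par z),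
        𝒯.Arranged 1 w (D w) (x w) := fun w hw => by
      have := Finset.mem_toList.1 (List.mem_of_mem_erase hw)
      exact hDx w (by rw [𝒯.lev_of_mem_kids this, 𝒯.lev_root])
    rcases exists_paired_of_even (fun a => decide (Even (𝒯.deg (x a)))) _ hlen with
      ⟨LO, hp', hLO⟩ | ⟨a, b, LO, hp', ha, hb, hLO⟩
    · obtain ⟨WO, hWO, hWOD⟩ := exists_reach_of_paired hLO fun w hw =>
        harr w (hp'.mem_iff.2 hw)
      exact ⟨LO, WO, hp'.symm, hWO, Or.inl hWOD⟩
    · obtain ⟨WO, hWO, hWOD⟩ := exists_reach_of_paired hLO fun w hw =>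
        harr w (hp'.mem_iff.2 (by simp [hw]))
      have hA := harr a (hp'.mem_iff.2 (by simp))
      have hB := harr b (hp'.mem_iff.2 (by simp))
      refine ⟨[b] ++ (LO ++ [a]), (x b :: (D b).reverse) ++ (WO ++ (D a ++ [x a])), ?_,
        hB.reach_reverse.append (hWO.append hA.1), Or.inr ⟨x b, (D b).reverse ++ (WO ++ D a),
        x a, by simp, by simpa using hb, by simpa using ha, hA.2.2,
        (hB.2.1.reverse fun _ _ => Domino.symm).append (hWOD.append hA.2.1)⟩⟩
      refine List.Perm.trans ?_ hp'.symm
      exact ((List.perm_append_singleton a LO).cons b).trans (.swap _ _ _)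
  obtain ⟨WZ, hWZ, hZcase⟩ := hZ
  obtain ⟨LO, WO, hLO, hWO, hOcase⟩ := hO
  have hR : 𝒯.Reach 2 [𝒯.root] (WO ++ WZ) := by
    refine .of_kids (c := LO ++ [𝒯.par z]) ?_ (hWO.append hWZ)
    exact (List.perm_append_singleton _ _).trans ((hLO.cons _).trans
      (List.perm_cons_erase (Finset.mem_toList.2 hZmem)).symm)
  have hev := hR.evens_eq hodd
  have hze : Even (𝒯.deg z) := by simp [hz0]
  rcases hZcase with ⟨D', rfl, hD'⟩ | ⟨e, D', o, rfl, he, he0, ho, hD'⟩ <;>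
    rcases hOcase with hWOD | ⟨o', D'', e', rfl, ho', he', he0', hD''⟩
  · -- the leaf comes last
    obtain ⟨E, hE, hm, hs⟩ := exists_serveAt_of_dominoes (hWOD.append hD') false
    refine hR.exists_graceful (W' := E ++ [z]) hodd hmax
      (by rw [← List.append_assoc]; exact hE.append_right [z])
      (by rw [List.map_append, hm]; simp) fun k => ?_
    rw [List.map_append, demand_append]
    refine hs k _ ?_
    rw [demand_zeros (by simp [hz0])]
    exact serveAt_zero _ _
  · exfalso
    have h1 := evens_even hD'
    have h2 := evens_even hD''
    have ho2 := Nat.not_even_iff_odd.2 ho'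
    simp only [evens_append, evens_cons, evens_nil, if_pos hze, if_pos he', if_neg ho2] at hev
    rw [Nat.even_iff] at h1 h2
    omega
  · exfalso
    have h1 := evens_even hD'
    have h2 := evens_even hWOD
    have ho2 := Nat.not_even_iff_odd.2 ho
    simp only [evens_append, evens_cons, evens_nil, if_pos hze, if_pos he, if_neg ho2] at hev
    rw [Nat.even_iff] at h1 h2
    omega
  · -- after the dominoes the phase is `true`, so that `o` is visited before the leaf `z`
    have hDD : Paired 𝒯.Domino (D'' ++ (e' :: e :: D')) :=
      hD''.append (.cons (Or.inr ⟨he', he, Or.inl ⟨he0', he0⟩⟩) hD')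
    have ho2 := Nat.not_even_iff_odd.2 ho
    have ho2' := Nat.not_even_iff_odd.2 ho'
    have h4 : 𝒯.evens (D'' ++ (e' :: e :: D')) % 4 = 2 := by
      simp only [evens_append, evens_cons, evens_nil, if_pos hze, if_pos he, if_neg ho2,
        if_pos he', if_neg ho2'] at hev ⊢
      omega
    obtain ⟨E, hE, hm, hs⟩ := exists_serveAt_of_dominoes hDD false
    refine hR.exists_graceful (W' := o' :: (E ++ [z, o])) hodd hmax ?_ ?_ fun k => ?_
    · simpa using (hE.append_right [z, o]).cons o'
    · simp [hm]
    · rw [List.map_cons, demand, List.map_append, demand_append]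
      refine .odd ho' (hs _ _ ?_)
      rw [h4]
      simp only [List.map_cons, List.map_nil, demand, hz0, Pi.single_zero, zero_add, add_zero,
        List.length_map, hE.length_eq]
      exact Serve.take_all _

/-! ### Three levels: sorting the grandchildren of the root by parity -/

lemma latticePath_flatMap {pos : V → ℤ} {f : V → List V} {G : List V} {k : ℤ}
    (hpos : PosFrom pos k G) (hf : ∀ u ∈ G, Odd (f u).length ∧ ∀ w ∈ f u, 𝒯.par w = u) :
    LatticePath pos k ((G.flatMap f).map 𝒯.par) (k + G.length) := by
  induction G generalizing k with
  | nil => simpa using LatticePath.nil k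
  | cons u G ih =>
    have e : k + ((u :: G).length : ℤ) = k + 1 + G.length := by simp; ring
    have ec : (f u).map 𝒯.par = List.replicate (f u).length u := by
      rw [List.eq_replicate_iff]
      simpa using (hf u (by simp)).2
    rw [List.flatMap_cons, List.map_append, ec, e]
    exact (LatticePath.replicate_up hpos.1 (hf u (by simp)).1).append
      (ih hpos.2 fun u hu => hf u (by simp [hu]))

lemma latticePath_reverse_flatMap {pos : V → ℤ} {f : V → List V} {G : List V} {k : ℤ}
    (hpos : PosFrom pos k G) (hf : ∀ u ∈ G, Odd (f u).length ∧ ∀ w ∈ f u, 𝒯.par w = u) :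
    LatticePath pos (k + G.length) ((G.reverse.flatMap f).map 𝒯.par) k := by
  induction G generalizing k with
  | nil => simpa using LatticePath.nil k
  | cons u G ih =>
    have e : k + ((u :: G).length : ℤ) = k + 1 + G.length := by simp; ring
    have ec : (f u).map 𝒯.par = List.replicate (f u).length u := by
      rw [List.eq_replicate_iff]
      simpa using (hf u (by simp)).2
    rw [List.reverse_cons, List.flatMap_append, List.map_append, List.flatMap_singleton, ec, e]
    exact (ih hpos.2 fun u hu => hf u (by simp [hu])).append
      (LatticePath.replicate_down hpos.1 (hf u (by simp)).1)

lemma Step.flatMap (G : List V) : 𝒯.Step G (G.flatMap fun u => (𝒯.kids u).toList) := by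
  induction G with
  | nil => exact .nil
  | cons u G ih => exact .cons (.refl _) ih

/-- If all vertices of the levels `0` and `1` have an odd number of children, then the vertices of
level `2` can be ordered such that those with an odd number of children come first. The children
of the root are sorted into four lists, according to the numbers of their children with an odd
(list `X`) and an even (list `Y`) number of children, one of which is odd and the other one even; a
lattice path going up, down and up again over these lists collects all of `X` before `Y`. -/
theorem exists_graceful_of_sorted (hodd : ∀ u, 𝒯.lev u < 2 → Odd (𝒯.deg u))
    (hmax : ∀ u, 𝒯.lev u ≤ 3)
    (hcase : (∀ u, 𝒯.lev u = 2 → Even (𝒯.deg u) → 𝒯.deg u = 0) ∨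
      ∀ u, 𝒯.lev u = 2 → 𝒯.deg u ≠ 0) : ∃ f, 𝒯.Graceful f := by
  set X : V → List V := fun u => (𝒯.kids u).toList.filter fun w => Odd (𝒯.deg w) with hX
  set Y : V → List V := fun u => (𝒯.kids u).toList.filter fun w => !decide (Odd (𝒯.deg w)) with hY
  set K : List V := (𝒯.kids 𝒯.root).toList with hK
  set A := K.filter fun u => Odd (X u).length with hA
  set B := K.filter fun u => !decide (Odd (X u).length) with hB
  set G₁ := A.filter fun u => (Y u).length = 0 with hG₁
  set G₂ := A.filter fun u => !decide ((Y u).length = 0) with hG₂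
  set G₃ := B.filter fun u => !decide ((X u).length = 0) with hG₃
  set G₄ := B.filter fun u => (X u).length = 0 with hG₄
  have hG : (G₁ ++ (G₂ ++ (G₃ ++ G₄))).Perm K := by
    rw [← List.append_assoc]
    exact ((List.filter_append_perm _ A).append
      (List.perm_append_comm.trans (List.filter_append_perm _ B))).trans
      (List.filter_append_perm _ K)
  set G := G₁ ++ (G₂ ++ (G₃ ++ G₄)) with hGdef
  have hXY : ∀ u, (X u ++ Y u).Perm (𝒯.kids u).toList := fun u => List.filter_append_perm _ _
  -- the lists `X u` and `Y u`, for `u` in the list `K`, have lengths of different parity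
  have hpar : ∀ u ∈ K, Odd ((X u).length + (Y u).length) := fun u hu => by
    rw [← List.length_append, (hXY u).length_eq, Finset.length_toList]
    rw [hK, Finset.mem_toList] at hu
    exact hodd u (by rw [𝒯.lev_of_mem_kids hu, 𝒯.lev_root]; omega)
  have hXp : ∀ u, ∀ w ∈ X u, 𝒯.par w = u := fun u w hw => by
    rw [hX, List.mem_filter, Finset.mem_toList, mem_kids] at hw
    exact hw.1.2
  have hYp : ∀ u, ∀ w ∈ Y u, 𝒯.par w = u := fun u w hw => by
    rw [hY, List.mem_filter, Finset.mem_toList, mem_kids] at hw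
    exact hw.1.2
  have h₁ : ∀ u ∈ G₁, Odd (X u).length ∧ (Y u).length = 0 := fun u hu => by
    simp only [hG₁, hA, List.mem_filter, decide_eq_true_eq] at hu
    exact ⟨hu.1.2, hu.2⟩
  have h₂ : ∀ u ∈ G₂, Odd (X u).length ∧ (Y u).length % 2 = 0 ∧ 2 ≤ (Y u).length := fun u hu => by
    simp only [hG₂, hA, List.mem_filter, decide_eq_true_eq, Bool.not_eq_true',
      decide_eq_false_iff_not] at hu
    have h := hpar u hu.1.1
    have h' := hu.1.2
    rw [Nat.odd_iff] at h h'
    exact ⟨hu.1.2, by omega, by omega⟩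
  have h₃ : ∀ u ∈ G₃, (X u).length % 2 = 0 ∧ 2 ≤ (X u).length ∧ Odd (Y u).length := fun u hu => by
    simp only [hG₃, hB, List.mem_filter, Bool.not_eq_true',
      decide_eq_false_iff_not] at hu
    have h := hpar u hu.1.1
    have h' := hu.1.2
    rw [Nat.odd_iff] at h h' ⊢
    exact ⟨by omega, by omega, by omega⟩
  have h₄ : ∀ u ∈ G₄, (X u).length = 0 ∧ Odd (Y u).length := fun u hu => by
    simp only [hG₄, hB, List.mem_filter, Bool.not_eq_true', decide_eq_true_eq,
      decide_eq_false_iff_not] at hu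
    have h := hpar u hu.1.1
    have h' := hu.1.2
    rw [Nat.odd_iff] at h h' ⊢
    exact ⟨by omega, by omega⟩
  set XW := G₁.flatMap X ++ (G₂.flatMap X ++ (G₃.flatMap (fun u => (X u).take 1) ++
    G₃.reverse.flatMap (fun u => (X u).drop 1))) with hXW
  set YW := G₂.reverse.flatMap (fun u => (Y u).take 1) ++ (G₂.flatMap (fun u => (Y u).drop 1) ++
    (G₃.flatMap Y ++ G₄.flatMap Y)) with hYW
  have hperm : (XW ++ YW).Perm (G.flatMap fun u => (𝒯.kids u).toList) := by
    have hr : ∀ (f : V → List V) (l : List V),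
        ((l.reverse.flatMap f : List V) : Multiset V) = (l.flatMap f : List V) := fun f l =>
      Multiset.coe_eq_coe.2 ((List.reverse_perm l).flatMap_right f)
    have hs : ∀ (f g h : V → List V) (l : List V), (∀ u, (f u ++ g u).Perm (h u)) →
        ((l.flatMap h : List V) : Multiset V) =
          (l.flatMap f : List V) + (l.flatMap g : List V) := fun f g h l hfg => by
      rw [Multiset.coe_add, Multiset.coe_eq_coe]
      exact ((List.flatMap_append_perm l f g).trans
        (List.Perm.flatMap_left l fun u _ => hfg u)).symm
    have h1 : G₁.flatMap Y = [] := by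
      rw [List.flatMap_eq_nil_iff]; exact fun u hu => List.length_eq_zero_iff.1 (h₁ u hu).2
    have h4 : G₄.flatMap X = [] := by
      rw [List.flatMap_eq_nil_iff]; exact fun u hu => List.length_eq_zero_iff.1 (h₄ u hu).1
    rw [← Multiset.coe_eq_coe]
    simp only [hXW, hYW, hGdef, List.flatMap_append, ← Multiset.coe_add, hr]
    rw [hs X Y _ G₁ hXY, hs X Y _ G₂ hXY, hs X Y _ G₃ hXY, hs X Y _ G₄ hXY, h1, h4,
      hs (fun u => (X u).take 1) (fun u => (X u).drop 1) X G₃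
        (fun u => .of_eq (List.take_append_drop 1 (X u))),
      hs (fun u => (Y u).take 1) (fun u => (Y u).drop 1) Y G₂
        (fun u => .of_eq (List.take_append_drop 1 (Y u)))]
    simp only [Multiset.coe_nil, add_zero, zero_add]
    abel
  have hstep : 𝒯.Step [𝒯.root] G := .single hG
  have hR : 𝒯.Reach 2 [𝒯.root] (G.flatMap fun u => (𝒯.kids u).toList) :=
    .succ hstep (.succ (Step.flatMap G) (.zero _))
  obtain ⟨-, -, -, -, hnd, -, hmem, -⟩ := hR.exists_latticePath_root hodd
  have hGmem : ∀ u, u ∈ G ↔ 𝒯.lev u = 1 := fun u => by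
    rw [hstep.mem, List.mem_singleton]
    constructor
    · rintro ⟨h1, h2⟩; rw [← 𝒯.lev_par u h1, h2, 𝒯.lev_root]
    · intro h1
      have hu : u ≠ 𝒯.root := by rintro rfl; rw [𝒯.lev_root] at h1; omega
      have := 𝒯.lev_par u hu
      exact ⟨hu, 𝒯.eq_root_of_lev (by omega)⟩
  have hW : ∀ u, u ∈ XW ++ YW ↔ 𝒯.lev u = 2 := fun u => by rw [hperm.mem_iff, hmem]
  have hpre : ∀ u, u ∈ 𝒯.root :: G ↔ 𝒯.lev u < 2 := fun u => by
    rw [List.mem_cons, hGmem]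
    constructor
    · rintro (rfl | h)
      · rw [𝒯.lev_root]; omega
      · omega
    · intro h
      by_cases h0 : 𝒯.lev u = 0
      · exact Or.inl (𝒯.eq_root_of_lev h0)
      · right; omega
  have hXodd : ∀ w ∈ XW, Odd (𝒯.deg w) := by
    have hXo : ∀ u, ∀ w ∈ X u, Odd (𝒯.deg w) := fun u w hw => by
      simpa using (List.mem_filter.1 hw).2
    intro w hw
    simp only [hXW, List.mem_append, List.mem_flatMap] at hw
    rcases hw with ⟨u, -, h⟩ | ⟨u, -, h⟩ | ⟨u, -, h⟩ | ⟨u, -, h⟩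
    · exact hXo u w h
    · exact hXo u w h
    · exact hXo u w (List.mem_of_mem_take h)
    · exact hXo u w (List.mem_of_mem_drop h)
  have hYeven : ∀ w ∈ YW, Even (𝒯.deg w) := by
    have hYe : ∀ u, ∀ w ∈ Y u, Even (𝒯.deg w) := fun u w hw => by
      simpa using (List.mem_filter.1 hw).2
    intro w hw
    simp only [hYW, List.mem_append, List.mem_flatMap] at hw
    rcases hw with ⟨u, -, h⟩ | ⟨u, -, h⟩ | ⟨u, -, h⟩ | ⟨u, -, h⟩
    · exact hYe u w (List.mem_of_mem_take h)
    · exact hYe u w (List.mem_of_mem_drop h)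
    · exact hYe u w h
    · exact hYe u w h
  refine exists_graceful_of_lists (j := 2) (pre := 𝒯.root :: G) (W := XW ++ YW)
    (ws := G ++ (XW ++ YW)) rfl ?_ hpre hW hmax ?_ ?_
  · rw [List.nodup_append]
    refine ⟨?_, hperm.nodup_iff.2 hnd, ?_⟩
    · rw [List.nodup_cons, hGmem, 𝒯.lev_root]
      exact ⟨by omega, hG.nodup_iff.2 (Finset.nodup_toList _)⟩
    · rintro a ha b hb rfl
      rw [hpre] at ha
      rw [hW] at hb
      omega
  · intro pos hpos
    have hroot : LatticePath pos 0 (G.map 𝒯.par) 1 := by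
      simpa using hstep.latticePath (fun u hu => hodd u (by
        rw [List.mem_singleton.1 hu, 𝒯.lev_root]; omega)) (k := 0) ⟨hpos.1, trivial⟩
    obtain ⟨hp₁, hp₂₃₄⟩ := posFrom_append.1 hpos.2
    obtain ⟨hp₂, hp₃₄⟩ := posFrom_append.1 hp₂₃₄
    obtain ⟨hp₃, hp₄⟩ := posFrom_append.1 hp₃₄
    have e : (((𝒯.root :: G).length : ℕ) : ℤ) =
        0 + 1 + G₁.length + G₂.length + G₃.length + G₄.length := by
      simp [hGdef]; ring
    rw [e, List.map_append]
    refine hroot.append ?_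
    simp only [hXW, hYW, List.map_append]
    have hle : ∀ u ∈ G₂, Odd ((Y u).take 1).length ∧ Odd ((Y u).drop 1).length := fun u hu => by
      have := h₂ u hu
      rw [List.length_take, List.length_drop, Nat.odd_iff, Nat.odd_iff]
      omega
    have hle' : ∀ u ∈ G₃, Odd ((X u).take 1).length ∧ Odd ((X u).drop 1).length := fun u hu => by
      have := h₃ u hu
      rw [List.length_take, List.length_drop, Nat.odd_iff, Nat.odd_iff]
      omega
    refine .append (.append (latticePath_flatMap hp₁ fun u hu => ⟨(h₁ u hu).1, hXp u⟩)
      (.append (latticePath_flatMap hp₂ fun u hu => ⟨(h₂ u hu).1, hXp u⟩)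
      (.append (latticePath_flatMap hp₃ fun u hu => ⟨(hle' u hu).1,
        fun w hw => hXp u w (List.mem_of_mem_take hw)⟩)
      (latticePath_reverse_flatMap hp₃ fun u hu => ⟨(hle' u hu).2,
        fun w hw => hXp u w (List.mem_of_mem_drop hw)⟩))))
      (.append (latticePath_reverse_flatMap hp₂ fun u hu => ⟨(hle u hu).1,
        fun w hw => hYp u w (List.mem_of_mem_take hw)⟩)
      (.append (latticePath_flatMap hp₂ fun u hu => ⟨(hle u hu).2,
        fun w hw => hYp u w (List.mem_of_mem_drop hw)⟩)
      (.append (latticePath_flatMap hp₃ fun u hu => ⟨(h₃ u hu).2.2, hYp u⟩)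
      (latticePath_flatMap hp₄ fun u hu => ⟨(h₄ u hu).2, hYp u⟩))))
  · rw [List.map_append]
    have hserve : ∀ k, ServeAt false k (demand k (YW.map 𝒯.deg)) := fun k => by
      rcases hcase with h | h
      · rw [demand_zeros]
        · exact serveAt_zero _ _
        · intro a ha
          obtain ⟨w, hw, rfl⟩ := List.mem_map.1 ha
          exact h w ((hW w).1 (by simp [hw])) (hYeven w hw)
      · rw [← add_zero (demand k _)]
        refine ServeAt.evens (fun a ha => ?_) (serveAt_zero _ _)
        obtain ⟨w, hw, rfl⟩ := List.mem_map.1 ha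
        exact ⟨hYeven w hw, h w ((hW w).1 (by simp [hw]))⟩
    exact ServeAt.odds (fun a ha => by
      obtain ⟨w, hw, rfl⟩ := List.mem_map.1 ha
      exact hXodd w hw) hserve

end ParentTree

/-! ### Trees as graphs -/

section Graph

variable {V : Type*} [Fintype V] [DecidableEq V] {T : SimpleGraph V}

lemma exists_adj_closer (hT : T.Connected) (v : V) {u : V} (hu : u ≠ v) :
    ∃ w, T.Adj u w ∧ T.dist v w + 1 = T.dist v u := by
  obtain ⟨p, hp⟩ := hT.exists_walk_length_eq_dist u v
  cases p with
  | nil => exact absurd rfl hu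
  | @cons _ w _ h p =>
    refine ⟨w, h, ?_⟩
    have h1 : T.dist w v ≤ p.length := SimpleGraph.dist_le p
    have h2 : T.dist u v ≤ T.dist u w + T.dist w v := hT.dist_triangle
    rw [SimpleGraph.dist_eq_one_iff_adj.2 h] at h2
    rw [SimpleGraph.Walk.length_cons] at hp
    rw [SimpleGraph.dist_comm (u := v), SimpleGraph.dist_comm (u := v)]
    omega

/-- The tree `T` rooted at `v`, with the parent of a vertex being a neighbor closer to `v`. -/
noncomputable def toParentTree (hT : T.IsTree) (v : V) : ParentTree V where
  root := v
  par u := if hu : u = v then v else (exists_adj_closer hT.connected v hu).choose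
  lev u := T.dist v u
  lev_root := by simp
  lev_par u hu := by
    rw [dif_neg hu]
    exact (exists_adj_closer hT.connected v hu).choose_spec.2

variable (hT : T.IsTree) (v : V)

lemma adj_par {u : V} (hu : u ≠ v) : T.Adj u ((toParentTree hT v).par u) := by
  simp only [toParentTree, dif_neg hu]
  exact (exists_adj_closer hT.connected v hu).choose_spec.1

/-- Each edge joins a vertex to its parent, because there are only `|V| - 1` edges. -/
lemma par_eq_or_of_adj {a b : V} (h : T.Adj a b) :
    a ≠ v ∧ (toParentTree hT v).par a = b ∨ b ≠ v ∧ (toParentTree hT v).par b = a := by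
  classical
  set 𝒯 := toParentTree hT v with h𝒯
  have hinj : Set.InjOn (fun u => s(u, 𝒯.par u)) ((Finset.univ.erase v : Finset V) : Set V) := by
    intro x hx y hy hxy
    have hx' : x ≠ 𝒯.root := (Finset.mem_erase.1 hx).1
    have hy' : y ≠ 𝒯.root := (Finset.mem_erase.1 hy).1
    have h1 := 𝒯.lev_par x hx'
    have h2 := 𝒯.lev_par y hy'
    rcases Sym2.eq_iff.1 hxy with ⟨h, -⟩ | ⟨h3, h4⟩
    · exact h
    · rw [h4] at h1
      rw [← h3] at h2
      omega
  have hsub : (Finset.univ.erase v).image (fun u => s(u, 𝒯.par u)) ⊆ T.edgeFinset := by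
    intro e he
    obtain ⟨u, hu, rfl⟩ := Finset.mem_image.1 he
    rw [SimpleGraph.mem_edgeFinset, SimpleGraph.mem_edgeSet]
    exact adj_par hT v (by simpa using hu)
  have hcard := hT.card_edgeFinset
  have himg := Finset.eq_of_subset_of_card_le hsub (by
    rw [Finset.card_image_of_injOn hinj, Finset.card_erase_of_mem (Finset.mem_univ v),
      Finset.card_univ]
    omega)
  have hab : s(a, b) ∈ T.edgeFinset := by
    rwa [SimpleGraph.mem_edgeFinset, SimpleGraph.mem_edgeSet]
  rw [← himg] at hab
  obtain ⟨u, hu, hue⟩ := Finset.mem_image.1 hab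
  have hu' : u ≠ v := by simpa using hu
  rcases Sym2.eq_iff.1 hue with ⟨rfl, h2⟩ | ⟨rfl, h2⟩
  · exact Or.inl ⟨hu', h2⟩
  · exact Or.inr ⟨hu', h2⟩

lemma children_eq_kids (u : V) : children T v u = (toParentTree hT v).kids u := by
  ext w
  rw [Finset.mem_coe, ParentTree.mem_kids]
  constructor
  · rintro ⟨h1, h2⟩
    rcases par_eq_or_of_adj hT v h1 with ⟨h3, h4⟩ | h
    · have := (toParentTree hT v).lev_par u h3
      rw [h4] at this
      change T.dist v w + 1 = T.dist v u at this
      omega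
    · exact h
  · rintro ⟨h1, rfl⟩
    exact ⟨(adj_par hT v h1).symm, ((toParentTree hT v).lev_par w h1).symm⟩

lemma numChildren_eq_deg (u : V) : numChildren T v u = (toParentTree hT v).deg u := by
  rw [numChildren, children_eq_kids hT v, Set.ncard_coe_finset, ParentTree.deg]

lemma isLeaf_iff_deg (u : V) : IsLeaf T v u ↔ (toParentTree hT v).deg u = 0 := by
  rw [IsLeaf, children_eq_kids hT v, Finset.coe_eq_empty, ParentTree.deg, Finset.card_eq_zero]

lemma isGracefulLabeling_of_graceful {f : V → ℤ} (hf : (toParentTree hT v).Graceful f) :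
    ∃ g : V → ℕ, IsGracefulLabeling T g ∧ g v = 0 := by
  obtain ⟨h0, hinj, hrange, hdiff⟩ := hf
  have hg : ∀ u, ((f u).toNat : ℤ) = f u := fun u => Int.toNat_of_nonneg (hrange u).1
  have hginj : Function.Injective fun u => (f u).toNat := fun a b hab => by
    apply hinj
    rw [← hg a, ← hg b]
    exact_mod_cast hab
  refine ⟨fun u => (f u).toNat, ⟨hginj, ?_, ?_⟩, ?_⟩
  · have h1 : Finset.univ.image (fun u => (f u).toNat) = Finset.range (Fintype.card V) := by
      refine Finset.eq_of_subset_of_card_le ?_ ?_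
      · intro k hk
        obtain ⟨u, -, rfl⟩ := Finset.mem_image.1 hk
        have := hrange u
        rw [Finset.mem_range]
        omega
      · rw [Finset.card_image_of_injective _ hginj, Finset.card_range, Finset.card_univ]
    ext k
    have := Finset.ext_iff.1 h1 k
    simpa using this
  · intro a b c d hab hcd he
    simp only [hg] at he
    rcases par_eq_or_of_adj hT v hab with ⟨h1, rfl⟩ | ⟨h1, rfl⟩ <;>
      rcases par_eq_or_of_adj hT v hcd with ⟨h2, rfl⟩ | ⟨h2, rfl⟩
    · rw [hdiff _ _ h1 h2 he]
    · rw [abs_sub_comm (f _) (f d)] at he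
      rw [hdiff _ _ h1 h2 he, Sym2.eq_swap]
    · rw [abs_sub_comm _ (f b)] at he
      rw [hdiff _ _ h1 h2 he, Sym2.eq_swap]
    · rw [abs_sub_comm _ (f b), abs_sub_comm _ (f d)] at he
      rw [hdiff _ _ h1 h2 he]
  · change f v = 0 at h0
    simp [h0]

lemma dist_le_lastLevel (u : V) : T.dist v u ≤ lastLevel T v :=
  Finset.le_sup (f := fun u => T.dist v u) (Finset.mem_univ u)

/-- A vertex is at distance at most `i` from its `i`-th ancestor. -/
lemma lev_iterate_par {u : V} {i : ℕ} (hi : i ≤ T.dist v u) :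
    T.dist v ((toParentTree hT v).par^[i] u) + i = T.dist v u ∧
      T.dist ((toParentTree hT v).par^[i] u) u ≤ i := by
  induction i with
  | zero => simp
  | succ i ih =>
    obtain ⟨h1, h2⟩ := ih (by omega)
    rw [Function.iterate_succ_apply']
    set y := (toParentTree hT v).par^[i] u
    have hy : y ≠ v := by
      intro e
      rw [e, SimpleGraph.dist_self] at h1
      omega
    have h3 : T.dist v ((toParentTree hT v).par y) + 1 = T.dist v y :=
      (toParentTree hT v).lev_par y hy
    have h4 := SimpleGraph.dist_eq_one_iff_adj.2 (adj_par hT v hy).symm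
    have h5 : T.dist ((toParentTree hT v).par y) u ≤ _ + T.dist y u := hT.connected.dist_triangle
    omega

/-- The last level of a tree rooted at a central vertex `v` is half of the diameter, if this is even.
Let `u` be a vertex of the last level `R`, and `w` the ancestor of `u` next to `v`. Some vertex `x`
is at distance at least `R` from `w`, as `v` is central; it is not a descendant of `w`, so that its
distance from `u` is at least `2 R - 1`. -/
lemma lastLevel_eq_of_diam_eq (hT : T.IsTree) {v : V} (hv : v ∈ T.center) {r : ℕ}
    (hr : T.diam = 2 * r) :
    lastLevel T v = r := by
  set 𝒯 := toParentTree hT v with h𝒯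
  set R := lastLevel T v with hR
  have : Nonempty V := ⟨v⟩
  have hup : T.diam ≤ 2 * R := by
    obtain ⟨a, b, hab⟩ := T.exists_dist_eq_diam
    have h1 : T.dist a b ≤ T.dist a v + T.dist v b := hT.connected.dist_triangle
    have h2 : T.dist v a ≤ R := dist_le_lastLevel v a
    have h3 : T.dist v b ≤ R := dist_le_lastLevel v b
    rw [SimpleGraph.dist_comm (u := a) (v := v)] at h1
    omega
  rcases Nat.eq_zero_or_pos R with h0 | hpos
  · omega
  obtain ⟨u, -, hu⟩ : ∃ u ∈ Finset.univ, R = T.dist v u :=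
    Finset.exists_mem_eq_sup Finset.univ Finset.univ_nonempty fun u : V => T.dist v u
  set w := 𝒯.par^[R - 1] u with hw
  have hwl : T.dist v w = 1 := by
    have := (lev_iterate_par hT v (u := u) (i := R - 1) (by omega)).1
    rw [← h𝒯, ← hw] at this
    omega
  obtain ⟨x, hx⟩ : ∃ x, R ≤ T.dist w x := by
    obtain ⟨x, hx⟩ := T.exists_edist_eq_eccent_of_finite w
    refine ⟨x, ?_⟩
    have h1 : T.eccent v ≤ T.eccent w := by
      rw [(SimpleGraph.mem_center_iff v).1 hv]; exact SimpleGraph.radius_le_eccent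
    have h2 : T.edist v u ≤ T.eccent v := SimpleGraph.edist_le_eccent
    have h3 := (h2.trans h1).trans hx.ge
    rw [← (hT.connected.preconnected v u).coe_dist_eq_edist,
      ← (hT.connected.preconnected w x).coe_dist_eq_edist] at h3
    rw [hu]
    exact_mod_cast h3
  -- the distance from `v`, with the opposite sign outside the branch of `w`
  have hlip : ∃ ψ : V → ℤ, (∀ y, 𝒯.par^[T.dist v y - 1] y = w → y ≠ v → ψ y = T.dist v y) ∧
      (∀ y, ¬ (𝒯.par^[T.dist v y - 1] y = w ∧ y ≠ v) → ψ y = - T.dist v y) ∧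
      ∀ y, y ≠ v → |ψ y - ψ (𝒯.par y)| ≤ 1 := by
    classical
    refine ⟨fun y => if 𝒯.par^[T.dist v y - 1] y = w ∧ y ≠ v then T.dist v y else - T.dist v y,
      fun y h1 h2 => if_pos ⟨h1, h2⟩, fun y h => if_neg h, fun y hy => ?_⟩
    have hl : T.dist v (𝒯.par y) + 1 = T.dist v y := 𝒯.lev_par y hy
    by_cases hp : 𝒯.par y = v
    · rw [hp, SimpleGraph.dist_self] at hl
      simp only [hp, SimpleGraph.dist_self, ne_eq, not_true_eq_false, and_false, if_false]
      split_ifs <;> simp [← hl]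
    · have e : 𝒯.par^[T.dist v y - 1] y = 𝒯.par^[T.dist v (𝒯.par y) - 1] (𝒯.par y) := by
        have hpp : T.dist v (𝒯.par y) ≠ 0 := fun h =>
          hp ((hT.connected.dist_eq_zero_iff).1 h).symm
        rw [← Function.iterate_succ_apply]
        congr 2
        omega
      simp only [e, hy, hp, ne_eq, not_false_eq_true, and_true]
      split_ifs <;> rw [abs_le] <;> constructor <;> omega
  obtain ⟨ψ, hψ1, hψ2, hψ3⟩ := hlip
  have hwalk : ∀ {a b : V} (p : T.Walk a b), ψ a - ψ b ≤ p.length := by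
    intro a b p
    induction p with
    | nil => simp
    | cons h p ih =>
      rw [SimpleGraph.Walk.length_cons]
      rcases par_eq_or_of_adj hT v h with ⟨h1, rfl⟩ | ⟨h1, rfl⟩
      · have := abs_le.1 (hψ3 _ h1)
        rw [h𝒯] at this
        push_cast; omega
      · have := abs_le.1 (hψ3 _ h1)
        rw [h𝒯] at this
        push_cast; omega
  have hxb : ¬ (𝒯.par^[T.dist v x - 1] x = w ∧ x ≠ v) := by
    rintro ⟨h1, h2⟩
    have h3 := (lev_iterate_par hT v (u := x) (i := T.dist v x - 1) (by omega)).2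
    rw [← h𝒯, h1] at h3
    have h4 : T.dist v x ≤ R := dist_le_lastLevel v x
    omega
  have huv : u ≠ v := by
    rintro rfl
    rw [SimpleGraph.dist_self] at hu
    omega
  have h1 := hψ1 u (by rw [← hu]) huv
  have h2 := hψ2 x hxb
  obtain ⟨p, hp⟩ := hT.connected.exists_walk_length_eq_dist u x
  have h3 := hwalk p
  have h4 : T.dist u x ≤ T.diam :=
    SimpleGraph.dist_le_diam (SimpleGraph.connected_iff_ediam_ne_top.1 hT.connected)
  have h5 : T.dist w x ≤ T.dist w v + T.dist v x := hT.connected.dist_triangle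
  rw [SimpleGraph.dist_comm (u := w) (v := v), hwl] at h5
  omega

lemma leafCondition_of_leafSiblingConditions {j : ℕ} (hj : 1 ≤ j)
    (h : LeafSiblingConditions T v (j + 1)) : (toParentTree hT v).LeafCondition j := by
  intro z hz hz0
  have hzr : z ≠ (toParentTree hT v).root := by
    intro e
    rw [e, ParentTree.lev_root] at hz
    omega
  have hzk : z ∈ (toParentTree hT v).kids ((toParentTree hT v).par z) :=
    (ParentTree.mem_kids _).2 ⟨hzr, rfl⟩
  have hlev : T.dist v z = j := hz
  have hleaf := (isLeaf_iff_deg hT v z).2 hz0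
  have huniq : ∀ w ∈ (toParentTree hT v).kids ((toParentTree hT v).par z), w ≠ z →
      (toParentTree hT v).deg w ≠ 0 := fun w hw hwz hw0 => by
    have hwl : T.dist v w = j := by
      have h1 := (toParentTree hT v).lev_of_mem_kids hw
      have h2 := (toParentTree hT v).lev_of_mem_kids hzk
      change T.dist v w = _ at h1
      omega
    refine h.1 z w (by omega) (by omega) hleaf ((isLeaf_iff_deg hT v w).2 hw0)
      ⟨hwz.symm, (toParentTree hT v).par z, ?_, ?_⟩ <;> rw [children_eq_kids hT v] <;> assumption
  refine ⟨?_, huniq⟩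
  obtain ⟨b, ⟨hzb, p, hp1, hp2⟩, hb⟩ := h.2 z (by omega) hleaf
  rw [children_eq_kids hT v, Finset.mem_coe] at hp1 hp2
  have hpz := ((ParentTree.mem_kids _).1 hp1).2
  rw [← hpz] at hp2
  exact ⟨b, hp2, by rwa [← numChildren_eq_deg], huniq b hp2 hzb.symm⟩

lemma ncard_evenVertices (j : ℕ) :
    (evenVertices T v (j + 1)).ncard = (toParentTree hT v).evensAt j := by
  rw [ParentTree.evensAt, ← Set.ncard_coe_finset]
  congr 1
  ext u
  simp only [evenVertices, numChildren_eq_deg hT v, Finset.coe_filter, Finset.mem_univ, true_and,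
    Set.mem_ofPred_eq, Nat.add_right_cancel_iff]
  rfl

end Graph

end GracefulTree

theorem mainTheorem1 {V : Type*} [Fintype V] (T : SimpleGraph V) (hT : T.IsTree)
    (v : V) (hv : v ∈ T.center)
    (hodd : ∀ u : V, T.dist v u + 1 < GracefulTree.lastLevel T v →
      Odd (GracefulTree.numChildren T v u))
    (h :
      -- (a)
      (T.diam = 6 ∧ GracefulTree.IsComplete T v) ∨
      -- (b)
      (T.diam = 6 ∧ GracefulTree.LeafSiblingConditions T v 3) ∨
      -- (c)
      (∃ r : ℕ, T.diam = 2 * r ∧ GracefulTree.IsComplete T v ∧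
        ¬ (GracefulTree.evenVertices T v r).ncard ≡ 3 [MOD 4]) ∨
      -- (d)
      (∃ r : ℕ, T.diam = 2 * r ∧
        ¬ (GracefulTree.evenVertices T v r).ncard ≡ 3 [MOD 4] ∧
        GracefulTree.LeafSiblingConditions T v r) ∨
      -- (e)
      (T.diam = 6 ∧ ∀ u : V, ¬ GracefulTree.IsLeaf T v u →
        Odd (GracefulTree.numChildren T v u))) :
    ∃ f : V → ℕ, GracefulTree.IsGracefulLabeling T f ∧ f v = 0 := by
  classical
  open GracefulTree in
  set 𝒯 := toParentTree hT v with h𝒯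
  suffices h : ∃ f, 𝒯.Graceful f by
    obtain ⟨f, hf⟩ := h
    exact isGracefulLabeling_of_graceful hT v hf
  have hmax : ∀ u, 𝒯.lev u ≤ lastLevel T v := fun u => dist_le_lastLevel v u
  have hodd' : ∀ u, 𝒯.lev u + 1 < lastLevel T v → Odd (𝒯.deg u) := fun u hu => by
    rw [h𝒯, ← numChildren_eq_deg]; exact hodd u hu
  have hcomplete : IsComplete T v → ∀ u, 𝒯.lev u < lastLevel T v → 𝒯.deg u ≠ 0 :=
    fun hc u hu h0 => by
      have : T.dist v u = _ := hc u ((isLeaf_iff_deg hT v u).2 h0)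
      change T.dist v u < _ at hu
      omega
  -- the argument for trees of arbitrary even diameter
  have general : ∀ r, lastLevel T v = r → (∀ j, 1 ≤ j → r = j + 1 → 𝒯.LeafCondition j) →
      ¬ (evenVertices T v r).ncard ≡ 3 [MOD 4] → ∃ f, 𝒯.Graceful f := by
    intro r hr hleaf hp
    rw [hr] at hmax hodd'
    rcases r with _ | j
    · refine ParentTree.exists_graceful_of_evensAt_mod_four (j := 0) (fun u hu => by omega)
        (fun u => (hmax u).trans (by omega)) (fun h => by omega) ?_
      have : 𝒯.evensAt 0 ≤ 1 := by
        rw [ParentTree.evensAt, Finset.card_le_one]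
        intro a ha b hb
        simp only [Finset.mem_filter, Finset.mem_univ, true_and] at ha hb
        rw [𝒯.eq_root_of_lev ha.1, 𝒯.eq_root_of_lev hb.1]
      omega
    · refine ParentTree.exists_graceful_of_evensAt_mod_four (fun u hu => hodd' u (by omega)) hmax
        (fun h => hleaf j h rfl) ?_
      rwa [ncard_evenVertices hT v] at hp
  rcases h with ⟨hd, hc⟩ | ⟨hd, hc⟩ | ⟨r, hd, hc, hp⟩ | ⟨r, hd, hp, hc⟩ | ⟨hd, hc⟩
  · have hr := lastLevel_eq_of_diam_eq hT hv (r := 3) hd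
    rw [hr] at hmax hodd' hcomplete
    exact ParentTree.exists_graceful_of_sorted (fun u hu => hodd' u (by omega)) hmax
      (Or.inr fun u hu => hcomplete hc u (by omega))
  · have hr := lastLevel_eq_of_diam_eq hT hv (r := 3) hd
    have hl := leafCondition_of_leafSiblingConditions hT v (j := 2) (by omega) hc
    by_cases hp : (evenVertices T v 3).ncard ≡ 3 [MOD 4]
    · rw [hr] at hmax hodd'
      by_cases hz : ∀ u, 𝒯.lev u = 2 → 𝒯.deg u ≠ 0
      · exact ParentTree.exists_graceful_of_sorted (fun u hu => hodd' u (by omega)) hmax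
          (Or.inr hz)
      · push Not at hz
        obtain ⟨z, hz, hz0⟩ := hz
        rw [ncard_evenVertices hT v 2] at hp
        exact ParentTree.exists_graceful_of_leaf (fun u hu => hodd' u (by omega)) hmax hl hp hz hz0
    · refine general 3 hr (fun j _ hj => ?_) hp
      obtain rfl : j = 2 := by omega
      exact hl
  · have hr := lastLevel_eq_of_diam_eq hT hv hd
    refine general r hr (fun j _ hj z hz hz0 => ?_) hp
    exact absurd hz0 (hcomplete hc z (by omega))
  · have hr := lastLevel_eq_of_diam_eq hT hv hd
    refine general r hr (fun j hj hj' => ?_) hp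
    subst hj'
    exact leafCondition_of_leafSiblingConditions hT v hj hc
  · have hr := lastLevel_eq_of_diam_eq hT hv (r := 3) hd
    rw [hr] at hmax hodd'
    refine ParentTree.exists_graceful_of_sorted (fun u hu => hodd' u (by omega)) hmax
      (Or.inl fun u _ hu => ?_)
    by_contra h0
    have := hc u (mt (isLeaf_iff_deg hT v u).1 h0)
    rw [numChildren_eq_deg hT v] at this
    exact Nat.not_even_iff_odd.2 this hu
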